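/- Let $M$ be a connected smooth $n$-dimensional manifold with a smooth (pseudo-)Riemannian metric $g$ of arbitrary signature, and let $A_1,\dots,A_n$ be smooth complex-valued 1-forms on $M$, linearly independent at every point, that factorize the metric: $g=\sum_{I=1}^n A_I\otimes A_I$, i.e. $g_{ab}=\sum_I A_{Ia}A_{Ib}$. Suppose that all the $A_I$ are closed, $dA_I=0$, but that they are not all exact, i.e. for at least one $I$ there is no smooth $\varphi:M\to\mathbb{C}$ with $A_I=d\varphi$. Then $M$ is not simply connected, it is non-curved, $R_{abcd}=0$, and: 1. the metric is not globally reducible to a Cartesian-like one: there are no smooth functions $\varphi_1,\dots,\varphi_n:M\to\mathbb{R}$ and signs $\varepsilon_a\in\{1,-1\}$ with $ds^2=\sum_{a=1}^n\varepsilon_a\,(d\varphi_a)^2$ on $M$; 2. the Levi-Civita connection is non-null in any global coordinates: there is no system of global coordinate functions on $M$ in which all the Christoffel symbols $\Gamma^c{}_{ab}$ vanish identically; 3. the geodesics are not straight lines in any global coordinates: there is no system of global coordinate functions $y$ on $M$ in which every geodesic, with affine parameter $s$, is a straight line $y=q+s\,v$ with $q,v\in\mathbb{R}^n$. Here a system of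 global coordinate functions is a map $y:M\to\mathbb{R}^n$ that restricts to a smooth chart on a neighbourhood of every point of $M$ (it need not be injective). -/

import Mathlib

open scoped Manifold ContDiff BigOperators

noncomputable section

namespace Takagi

/-- The model space of an `n`-dimensional manifold. -/
abbrev Model (n : ℕ) : Type := EuclideanSpace ℝ (Fin n)

variable {n : ℕ} {M : Type*} [TopologicalSpace M] [ChartedSpace (Model n) M]

/-- `e` is a smooth coordinate chart of `M` (a member of the maximal smooth atlas). -/
def IsChart (e : OpenPartialHomeomorph M (Model n)) : Prop :=
  e ∈ IsManifold.maximalAtlas (𝓡 n) ∞ M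

/-- The `a`-th vector of the standard basis of `ℝⁿ`. -/
def stdVec (n : ℕ) (a : Fin n) : Model n := EuclideanSpace.single a (1 : ℝ)

/-- The ordinary partial derivative `∂_a f` of a function of the coordinates. -/
def partialDeriv {F : Type*} [NormedAddCommGroup F] [NormedSpace ℝ F]
    (a : Fin n) (f : Model n → F) (x : Model n) : F :=
  fderiv ℝ f x (stdVec n a)

/-- The coordinate vector field `∂_a` of the chart `e`, at the point with coordinates `x`. -/
def coordVec (e : OpenPartialHomeomorph M (Model n)) (x : Model n) (a : Fin n) :
    TangentSpace (𝓡 n) (e.symm x) :=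
  mfderiv (𝓡 n) (𝓡 n) e.symm x (stdVec n a)

/-! ### Complex 1-forms -/

variable (n M) in
/-- Complex-valued 1-forms on `M` (smoothness is a separate predicate). -/
abbrev OneForm : Type _ := ∀ p : M, TangentSpace (𝓡 n) p →L[ℝ] ℂ

/-- The component `A_a` of a 1-form in a chart. -/
def OneForm.comp (A : OneForm n M) (e : OpenPartialHomeomorph M (Model n)) (a : Fin n)
    (x : Model n) : ℂ :=
  A (e.symm x) (coordVec e x a)

/-- A 1-form is smooth if its components are smooth in every chart. -/
def OneForm.IsSmooth (A : OneForm n M) : Prop :=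
  ∀ e : OpenPartialHomeomorph M (Model n), IsChart e →
    ∀ a, ContDiffOn ℝ ∞ (A.comp e a) e.target

/-- The components `F_{ab} = ∂_a A_b - ∂_b A_a` of the exterior derivative `F = dA`. -/
def OneForm.extDerivComp (A : OneForm n M) (e : OpenPartialHomeomorph M (Model n))
    (a b : Fin n) (x : Model n) : ℂ :=
  partialDeriv a (A.comp e b) x - partialDeriv b (A.comp e a) x

/-- `dA = 0`. -/
def OneForm.IsClosed (A : OneForm n M) : Prop :=
  ∀ e : OpenPartialHomeomorph M (Model n), IsChart e →
    ∀ x ∈ e.target, ∀ a b, A.extDerivComp e a b x = 0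

/-- `A = dφ` for a globally defined smooth function `φ`. -/
def OneForm.IsExact (A : OneForm n M) : Prop :=
  ∃ φ : M → ℂ, ContMDiff (𝓡 n) 𝓘(ℝ, ℂ) ∞ φ ∧
    ∀ (p : M) (v : TangentSpace (𝓡 n) p), A p v = mfderiv (𝓡 n) 𝓘(ℝ, ℂ) φ p v

/-! ### Metrics -/

variable (n M) in
/-- A smooth pseudo-Riemannian metric on `M`, of arbitrary signature. -/
structure Metric where
  /-- the bilinear form on each tangent space -/
  val : ∀ p : M, TangentSpace (𝓡 n) p →L[ℝ] TangentSpace (𝓡 n) p →L[ℝ] ℝ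
  symm : ∀ (p : M) (v w : TangentSpace (𝓡 n) p), val p v w = val p w v
  nondegenerate : ∀ (p : M) (v : TangentSpace (𝓡 n) p), (∀ w, val p v w = 0) → v = 0
  smooth : ∀ e : OpenPartialHomeomorph M (Model n), IsChart e → ∀ a b : Fin n,
    ContDiffOn ℝ ∞ (fun x => val (e.symm x) (coordVec e x a) (coordVec e x b)) e.target

namespace Metric

variable (g : Metric n M)

/-- The components `g_{ab}` of the metric in a chart. -/
def comp (e : OpenPartialHomeomorph M (Model n)) (a b : Fin n) (x : Model n) : ℝ :=
  g.val (e.symm x) (coordVec e x a) (coordVec e x b)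

/-- The components `g^{ab}` of the inverse metric in a chart. -/
def invComp (e : OpenPartialHomeomorph M (Model n)) (a b : Fin n) (x : Model n) : ℝ :=
  (Matrix.of fun i j => g.comp e i j x)⁻¹ a b

/-- The Christoffel symbols `Γ^c_{ab}` of the Levi-Civita connection in a chart. -/
def christoffel (e : OpenPartialHomeomorph M (Model n)) (c a b : Fin n) (x : Model n) : ℝ :=
  ∑ d, g.invComp e c d x * ((1 / 2 : ℝ) *
    (partialDeriv a (g.comp e d b) x + partialDeriv b (g.comp e d a) x
      - partialDeriv d (g.comp e a b) x))

/-- The curvature components `R^a_{bcd}` in a chart. -/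
def curvatureUp (e : OpenPartialHomeomorph M (Model n)) (a b c d : Fin n) (x : Model n) : ℝ :=
  partialDeriv c (g.christoffel e a b d) x - partialDeriv d (g.christoffel e a b c) x
    + ∑ k, g.christoffel e a k c x * g.christoffel e k b d x
    - ∑ k, g.christoffel e a k d x * g.christoffel e k b c x

/-- The curvature components `R_{abcd}` in a chart. -/
def curvature (e : OpenPartialHomeomorph M (Model n)) (a b c d : Fin n) (x : Model n) : ℝ :=
  ∑ k, g.comp e a k x * g.curvatureUp e k b c d x

/-- `R_{abcd} = 0` everywhere. -/
def IsNonCurved : Prop :=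
  ∀ e : OpenPartialHomeomorph M (Model n), IsChart e →
    ∀ x ∈ e.target, ∀ a b c d, g.curvature e a b c d x = 0

/-- `γ` is a geodesic, with affine parameter in the open interval `(s₀, s₁)`: in every chart,
`d²x^c/ds² + Γ^c_{ab} (dx^a/ds) (dx^b/ds) = 0`. -/
def IsGeodesicOn (γ : ℝ → M) (s₀ s₁ : ℝ) : Prop :=
  ContMDiffOn 𝓘(ℝ, ℝ) (𝓡 n) ∞ γ (Set.Ioo s₀ s₁) ∧
  ∀ e : OpenPartialHomeomorph M (Model n), IsChart e →
    ∀ s ∈ Set.Ioo s₀ s₁, γ s ∈ e.source → ∀ c : Fin n,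
      deriv (deriv fun t => e (γ t) c) s
        + ∑ a, ∑ b, g.christoffel e c a b (e (γ s))
            * deriv (fun t => e (γ t) a) s * deriv (fun t => e (γ t) b) s = 0

/-- `A_1, …, A_n` is a Takagi factorization of `g`: smooth, pointwise linearly independent
complex 1-forms with `g_{ab} = ∑ I, A_{Ia} A_{Ib}`. -/
structure IsTakagiFactorization (A : Fin n → OneForm n M) : Prop where
  smooth : ∀ I, (A I).IsSmooth
  linearIndependent : ∀ p : M, LinearIndependent ℂ fun I => A I p
  factor : ∀ (p : M) (v w : TangentSpace (𝓡 n) p),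
    (g.val p v w : ℂ) = ∑ I, A I p v * A I p w

/-- The metric is globally reducible to a Cartesian-like one: there are functions
`φ_1, …, φ_n` on all of `M` and signs `ε_a = ±1` with `ds² = ∑ a, ε_a (dφ_a)²`. -/
def IsGloballyCartesian : Prop :=
  ∃ (ε : Fin n → ℝ) (φ : Fin n → M → ℝ),
    (∀ a, ε a = 1 ∨ ε a = -1) ∧
    (∀ a, ContMDiff (𝓡 n) 𝓘(ℝ, ℝ) ∞ (φ a)) ∧
    ∀ (p : M) (v w : TangentSpace (𝓡 n) p),
      g.val p v w = ∑ a, ε a * (show ℝ from mfderiv (𝓡 n) 𝓘(ℝ, ℝ) (φ a) p v)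
        * (show ℝ from mfderiv (𝓡 n) 𝓘(ℝ, ℝ) (φ a) p w)

end Metric

/-! ### Global coordinates -/

/-- `y : M → ℝⁿ` is a system of `n` globally defined coordinate functions: near every point it
restricts to a chart. Injectivity on all of `M` is not required, so every global chart is
included. -/
def IsGlobalCoordinates (y : M → Model n) : Prop :=
  ∀ p : M, ∃ e : OpenPartialHomeomorph M (Model n),
    IsChart e ∧ p ∈ e.source ∧ Set.EqOn y e e.source

/-- All the Christoffel symbols vanish identically in the global coordinates `y`. -/
def Metric.ConnectionNullIn (g : Metric n M) (y : M → Model n) : Prop :=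
  ∀ e : OpenPartialHomeomorph M (Model n), IsChart e → Set.EqOn y e e.source →
    ∀ x ∈ e.target, ∀ c a b, g.christoffel e c a b x = 0

/-- Every geodesic is a straight line `y = q + s v` in the global coordinates `y`. -/
def Metric.GeodesicsStraightIn (g : Metric n M) (y : M → Model n) : Prop :=
  ∀ (s₀ s₁ : ℝ) (γ : ℝ → M), s₀ < s₁ → g.IsGeodesicOn γ s₀ s₁ →
    ∃ q v : Model n, ∀ s ∈ Set.Ioo s₀ s₁, y (γ s) = q + s • v

end Takagi

end

noncomputable section

namespace Takagi

/-! ### Partial derivatives of matrix-valued functions -/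

section Calculus

variable {n : ℕ}

/-! Closedness makes the coframe parallel. Insert `g = ∑ A_I ⊗ A_I` into the Christoffel formula:
the symmetry `∂_a A_b = ∂_b A_a` collapses the lowered symbol to `∑ A_{Id} ∂_a A_{Ib}`, and
inverting the matrix `F = (A_{Ia})` gives `∂_a F = F Γ_a` (`matDeriv_frame`). Symmetry of the second
derivatives of `F` is then the vanishing of the curvature.

If another coframe `G` satisfies the same equation, `F G⁻¹` has zero derivative. On a connected
manifold the two coframes therefore differ by a constant complex matrix
(`exists_const_matrix_of_parallel`), and if `G` consists of exact forms, so does `F`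
(`isExact_of_parallel`). Each excluded global structure supplies such a `G`: a Cartesian form of the
metric gives `√ε_a dφ_a`, and coordinates with null connection give `dy_a`.

Straight geodesics reduce to a null connection. Every initial velocity is realized by a geodesic
(`exists_geodesic`), so straightness kills the quadratic form `Γ^c_{ab} w^a w^b`, and polarization
kills `Γ`. These geodesics are lines in local flat coordinates. Such coordinates must be real
although the forms are complex; this works because `Γ` is real, so that `F` and its conjugate are
parallel for the same connection (`frame_inv_mul_real`).

The topological claim is that closed forms are exact on a simply connected manifold: local
primitives from the Poincaré lemma are sheets of a covering space with fibre the discrete complex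
numbers, and a section of it is a global primitive (`exists_glued_function`). -/

theorem partialDeriv_congr {F : Type*} [NormedAddCommGroup F] [NormedSpace ℝ F] {a : Fin n}
    {f g : Model n → F} {x : Model n} (h : f =ᶠ[nhds x] g) :
    partialDeriv a f x = partialDeriv a g x := by
  simp only [partialDeriv, h.fderiv_eq]

theorem partialDeriv_const {F : Type*} [NormedAddCommGroup F] [NormedSpace ℝ F] (a : Fin n)
    (c : F) (x : Model n) : partialDeriv a (fun _ => c) x = 0 := by
  simp [partialDeriv]

theorem partialDeriv_mul {𝔸 : Type*} [NormedCommRing 𝔸] [NormedAlgebra ℝ 𝔸] {a : Fin n}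
    {f g : Model n → 𝔸} {x : Model n} (hf : DifferentiableAt ℝ f x)
    (hg : DifferentiableAt ℝ g x) :
    partialDeriv a (fun y => f y * g y) x
      = partialDeriv a f x * g x + f x * partialDeriv a g x := by
  simp only [partialDeriv, fderiv_fun_mul hf hg]
  simp [mul_comm, add_comm]

theorem partialDeriv_sum {F ι : Type*} [NormedAddCommGroup F] [NormedSpace ℝ F] {a : Fin n}
    {s : Finset ι} {f : ι → Model n → F} {x : Model n}
    (hf : ∀ i ∈ s, DifferentiableAt ℝ (f i) x) :
    partialDeriv a (fun y => ∑ i ∈ s, f i y) x = ∑ i ∈ s, partialDeriv a (f i) x := by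
  simp only [partialDeriv, fderiv_fun_sum hf, sum_apply]

theorem partialDeriv_ofReal {a : Fin n} {f : Model n → ℝ} {x : Model n}
    (hf : DifferentiableAt ℝ f x) :
    partialDeriv a (fun y => (f y : ℂ)) x = ((partialDeriv a f x : ℝ) : ℂ) := by
  have h := Complex.ofRealCLM.hasFDerivAt.comp x hf.hasFDerivAt
  have h' : fderiv ℝ (fun y => (f y : ℂ)) x = Complex.ofRealCLM.comp (fderiv ℝ f x) := h.fderiv
  simp [partialDeriv, h']

theorem partialDeriv_conj {a : Fin n} {f : Model n → ℂ} {x : Model n}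
    (hf : DifferentiableAt ℝ f x) :
    partialDeriv a (fun y => star (f y)) x = star (partialDeriv a f x) := by
  have h := (Complex.conjCLE : ℂ →L[ℝ] ℂ).hasFDerivAt.comp x hf.hasFDerivAt
  have h' : fderiv ℝ (fun y => star (f y)) x
      = (Complex.conjCLE : ℂ →L[ℝ] ℂ).comp (fderiv ℝ f x) := h.fderiv
  rw [partialDeriv, h']
  rfl

theorem sum_smul_stdVec (v : Model n) : ∑ a, v a • stdVec n a = v := by
  ext i
  simp [stdVec, Pi.single_apply]

theorem fderiv_eq_sum_partialDeriv {F : Type*} [NormedAddCommGroup F] [NormedSpace ℝ F]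
    (f : Model n → F) (x v : Model n) :
    fderiv ℝ f x v = ∑ a, v a • partialDeriv a f x := by
  conv_lhs => rw [← sum_smul_stdVec v]
  simp [partialDeriv]

theorem fderiv_eq_zero_of_partialDeriv {F : Type*} [NormedAddCommGroup F] [NormedSpace ℝ F]
    {f : Model n → F} {x : Model n} (h : ∀ a, partialDeriv a f x = 0) : fderiv ℝ f x = 0 := by
  ext v
  simp [fderiv_eq_sum_partialDeriv, h]

theorem contDiffOn_partialDeriv {F : Type*} [NormedAddCommGroup F] [NormedSpace ℝ F]
    {f : Model n → F} {U : Set (Model n)} (hU : IsOpen U) (hf : ContDiffOn ℝ ∞ f U) (a : Fin n) :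
    ContDiffOn ℝ ∞ (partialDeriv a f) U :=
  (hf.fderiv_of_isOpen hU (m := ∞) (by simp)).clm_apply contDiffOn_const

theorem partialDeriv_comm {F : Type*} [NormedAddCommGroup F] [NormedSpace ℝ F]
    {f : Model n → F} {U : Set (Model n)} (hU : IsOpen U) (hf : ContDiffOn ℝ ∞ f U)
    (a b : Fin n) {x : Model n} (hx : x ∈ U) :
    partialDeriv a (partialDeriv b f) x = partialDeriv b (partialDeriv a f) x := by
  have hd : DifferentiableAt ℝ (fderiv ℝ f) x :=
    ((hf.fderiv_of_isOpen hU (m := ∞) (by simp)).contDiffAt (hU.mem_nhds hx)).differentiableAt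
      (by simp)
  have hs := (hf.contDiffAt (hU.mem_nhds hx)).isSymmSndFDerivAt 
    (by simpa using! WithTop.coe_le_coe.2 (le_top : (2 : ℕ∞) ≤ ⊤))
  have key : ∀ a b : Fin n, partialDeriv a (partialDeriv b f) x
      = fderiv ℝ (fderiv ℝ f) x (stdVec n a) (stdVec n b) := by
    intro a b
    have h : HasFDerivAt (fun y => fderiv ℝ f y (stdVec n b))
        ((fderiv ℝ (fderiv ℝ f) x).flip (stdVec n b)) x := by
      simpa using hd.hasFDerivAt.clm_apply (hasFDerivAt_const (stdVec n b) x)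
    change fderiv ℝ (fun y => fderiv ℝ f y (stdVec n b)) x (stdVec n a) = _
    rw [h.fderiv]; rfl
  rw [key, key, hs.eq]

/-- The entrywise partial derivative of a matrix-valued function. -/
def matDeriv (a : Fin n) (X : Model n → Matrix (Fin n) (Fin n) ℂ) (x : Model n) :
    Matrix (Fin n) (Fin n) ℂ :=
  Matrix.of fun i j => partialDeriv a (fun y => X y i j) x

theorem matDeriv_mul {a : Fin n} {X Y : Model n → Matrix (Fin n) (Fin n) ℂ} {x : Model n}
    (hX : ∀ i j, DifferentiableAt ℝ (fun y => X y i j) x)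
    (hY : ∀ i j, DifferentiableAt ℝ (fun y => Y y i j) x) :
    matDeriv a (fun y => X y * Y y) x = matDeriv a X x * Y x + X x * matDeriv a Y x := by
  ext i j
  simp only [matDeriv, Matrix.of_apply, Matrix.mul_apply, Matrix.add_apply]
  rw [partialDeriv_sum fun k _ => (hX i k).fun_mul (hY k j), ← Finset.sum_add_distrib]
  exact Finset.sum_congr rfl fun k _ => partialDeriv_mul (hX i k) (hY k j)

theorem matDeriv_congr {a : Fin n} {X Y : Model n → Matrix (Fin n) (Fin n) ℂ} {x : Model n}
    (h : X =ᶠ[nhds x] Y) : matDeriv a X x = matDeriv a Y x := by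
  ext i j
  exact partialDeriv_congr (h.mono fun y hy => by simp only [hy])

/-! ### Smoothness of determinants and inverses of matrix-valued functions -/

section Inverse

variable {𝕜 : Type*} [RCLike 𝕜]

theorem contDiffAt_matrix_det {X : Model n → Matrix (Fin n) (Fin n) 𝕜} {x : Model n}
    (hX : ∀ i j, ContDiffAt ℝ ∞ (fun y => X y i j) x) :
    ContDiffAt ℝ ∞ (fun y => (X y).det) x := by
  simp only [Matrix.det_apply]
  exact ContDiffAt.sum fun σ _ => (contDiffAt_prod fun i _ => hX _ _).const_smul _

theorem contDiffAt_matrix_inv {X : Model n → Matrix (Fin n) (Fin n) 𝕜} {x : Model n}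
    (hX : ∀ i j, ContDiffAt ℝ ∞ (fun y => X y i j) x) (hdet : (X x).det ≠ 0) (i j : Fin n) :
    ContDiffAt ℝ ∞ (fun y => (X y)⁻¹ i j) x := by
  simp only [Matrix.inv_def, Matrix.smul_apply, Ring.inverse_eq_inv', Matrix.adjugate_apply,
    smul_eq_mul]
  refine ((contDiffAt_matrix_det hX).inv hdet).mul (contDiffAt_matrix_det fun k l => ?_)
  by_cases hk : k = j
  · subst hk
    simpa using contDiffAt_const
  · simpa [Matrix.updateRow_ne hk] using hX k l

end Inverse

/-- Differentiate `Y⁻¹ Y = 1`, which holds near `x` because the determinant stays nonzero there. -/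
theorem matDeriv_inv {a : Fin n} {Y : Model n → Matrix (Fin n) (Fin n) ℂ} {x : Model n}
    (hY : ∀ i j, ContDiffAt ℝ ∞ (fun y => Y y i j) x) (hdet : (Y x).det ≠ 0) :
    matDeriv a (fun y => (Y y)⁻¹) x = -((Y x)⁻¹ * matDeriv a Y x * (Y x)⁻¹) := by
  have hd : ∀ᶠ y in nhds x, (Y y).det ≠ 0 :=
    (contDiffAt_matrix_det hY).continuousAt.eventually_ne hdet
  have h1 : matDeriv a (fun y => (Y y)⁻¹ * Y y) x = 0 := by
    rw [matDeriv_congr (Y := fun _ => 1)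
      (hd.mono fun y hy => Matrix.nonsing_inv_mul _ (isUnit_iff_ne_zero.2 hy))]
    ext i j
    exact partialDeriv_const _ _ _
  rw [matDeriv_mul
    (fun i j => (contDiffAt_matrix_inv hY hdet i j).differentiableAt (by simp))
    (fun i j => (hY i j).differentiableAt (by simp))] at h1
  have hu := isUnit_iff_ne_zero.2 hdet
  have h2 := congrArg (· * (Y x)⁻¹) (eq_neg_of_add_eq_zero_left h1)
  simpa [Matrix.mul_assoc, Matrix.mul_nonsing_inv _ hu] using h2

/-- Two frames that are parallel for the same connection differ by a matrix with vanishing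
derivative. -/
theorem fderiv_mul_inv_eq_zero {X Y : Model n → Matrix (Fin n) (Fin n) ℂ}
    {Γ : Fin n → Matrix (Fin n) (Fin n) ℂ} {x : Model n}
    (hX : ∀ i j, ContDiffAt ℝ ∞ (fun y => X y i j) x)
    (hY : ∀ i j, ContDiffAt ℝ ∞ (fun y => Y y i j) x) (hdet : (Y x).det ≠ 0)
    (hXΓ : ∀ a, matDeriv a X x = X x * Γ a) (hYΓ : ∀ a, matDeriv a Y x = Y x * Γ a)
    (i j : Fin n) : fderiv ℝ (fun y => (X y * (Y y)⁻¹) i j) x = 0 := by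
  refine fderiv_eq_zero_of_partialDeriv fun a => ?_
  have hu := isUnit_iff_ne_zero.2 hdet
  have h : matDeriv a (fun y => X y * (Y y)⁻¹) x = 0 := by
    rw [matDeriv_mul (fun i j => (hX i j).differentiableAt (by simp))
      (fun i j => (contDiffAt_matrix_inv hY hdet i j).differentiableAt (by simp)),
      matDeriv_inv hY hdet, hXΓ, hYΓ, ← Matrix.mul_assoc, Matrix.nonsing_inv_mul _ hu,
      Matrix.one_mul, Matrix.mul_neg, Matrix.mul_assoc, add_neg_cancel]
  exact congrFun (congrFun h i) j

end Calculus

section Frame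

variable {n : ℕ} {M : Type*} [TopologicalSpace M] [ChartedSpace (Model n) M]
  {e : OpenPartialHomeomorph M (Model n)} {g : Metric n M} {A : Fin n → OneForm n M}

/-! ### Charts and the components of a coframe -/

theorem IsChart.mdifferentiable (he : IsChart e) : e.MDifferentiable (𝓡 n) (𝓡 n) :=
  ⟨(contMDiffOn_of_mem_maximalAtlas he).mdifferentiableOn (by simp),
    (contMDiffOn_symm_of_mem_maximalAtlas he).mdifferentiableOn (by simp)⟩

/-- The matrix `A_{Ia}` of components of a family of 1-forms in a chart. -/
def frame (A : Fin n → OneForm n M) (e : OpenPartialHomeomorph M (Model n)) (x : Model n) :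
    Matrix (Fin n) (Fin n) ℂ :=
  Matrix.of fun I a => (A I).comp e a x

/-- A 1-form read in a chart, as a function on the model space. -/
def OneForm.pullback (A : OneForm n M) (e : OpenPartialHomeomorph M (Model n)) (x : Model n) :
    Model n →L[ℝ] ℂ :=
  (A (e.symm x)).comp (mfderiv (𝓡 n) (𝓡 n) e.symm x)

theorem OneForm.pullback_stdVec (A : OneForm n M) (x : Model n) (a : Fin n) :
    A.pullback e x (stdVec n a) = A.comp e a x := rfl

theorem OneForm.pullback_apply (A : OneForm n M) (x v : Model n) :
    A.pullback e x v = ∑ a, v a • A.comp e a x := by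
  conv_lhs => rw [← sum_smul_stdVec v]
  simp [OneForm.pullback_stdVec]

theorem contDiffAt_frame (hA : ∀ I, (A I).IsSmooth) (he : IsChart e) {x : Model n}
    (hx : x ∈ e.target) (I a : Fin n) : ContDiffAt ℝ ∞ (fun y => frame A e y I a) x :=
  (hA I e he a).contDiffAt (e.open_target.mem_nhds hx)

theorem differentiableAt_frame (hA : ∀ I, (A I).IsSmooth) (he : IsChart e) {x : Model n}
    (hx : x ∈ e.target) (I a : Fin n) : DifferentiableAt ℝ (fun y => frame A e y I a) x :=
  (contDiffAt_frame hA he hx I a).differentiableAt (by simp)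

/-- A left null vector of the component matrix gives a relation between the forms on the coordinate
vectors. These span the tangent space, because the derivative of `e.symm` is surjective, so the
relation holds between the forms themselves. -/
theorem det_frame_ne_zero [IsManifold (𝓡 n) ∞ M] (hA : ∀ p, LinearIndependent ℂ fun I => A I p)
    (he : IsChart e) {x : Model n} (hx : x ∈ e.target) : (frame A e x).det ≠ 0 := by
  have : IsManifold (𝓡 n) 1 M := IsManifold.of_le (n := ∞) (by simp)
  intro h
  obtain ⟨v, hv, hv0⟩ := Matrix.exists_vecMul_eq_zero_iff.2 h
  apply hv
  refine funext (Fintype.linearIndependent_iff.1 (hA (e.symm x)) v ?_)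
  have h1 : ∀ w : Model n, ∑ I, v I * (A I).pullback e x w = 0 := by
    intro w
    simp only [OneForm.pullback_apply, Finset.mul_sum]
    rw [Finset.sum_comm]
    refine Finset.sum_eq_zero fun a _ => ?_
    have h2 : ∑ I, v I * (A I).comp e a x = 0 := congrFun hv0 a
    rw [show ∑ I, v I * w a • (A I).comp e a x = w a • ∑ I, v I * (A I).comp e a x by
      simp [Finset.mul_sum, mul_left_comm], h2, smul_zero]
  ext w
  obtain ⟨u, rfl⟩ := he.mdifferentiable.symm.mfderiv_surjective (x := x) hx w
  have h3 := h1 u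
  rw [sum_apply]
  exact h3

/-! ### The Levi-Civita connection of a closed factorization -/

/-- The connection matrix `(Γ_a)^c_b` in a chart. -/
def connMatrix (g : Metric n M) (e : OpenPartialHomeomorph M (Model n)) (a : Fin n)
    (x : Model n) : Matrix (Fin n) (Fin n) ℂ :=
  Matrix.of fun c b => (g.christoffel e c a b x : ℂ)

theorem Metric.comp_symm (g : Metric n M) (e : OpenPartialHomeomorph M (Model n)) (a b : Fin n) :
    g.comp e a b = g.comp e b a :=
  funext fun _ => g.symm _ _ _

theorem Metric.christoffel_symm (g : Metric n M) (e : OpenPartialHomeomorph M (Model n))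
    (c a b : Fin n) : g.christoffel e c a b = g.christoffel e c b a := by
  funext x
  simp only [Metric.christoffel, g.comp_symm e a b]
  exact Finset.sum_congr rfl fun d _ => by ring

theorem Metric.contDiffAt_comp (g : Metric n M) (he : IsChart e) {x : Model n}
    (hx : x ∈ e.target) (a b : Fin n) : ContDiffAt ℝ ∞ (g.comp e a b) x :=
  (g.smooth e he a b).contDiffAt (e.open_target.mem_nhds hx)

/-- Only the factorization identity is assumed, so this also applies to a coframe whose independence
is still to be deduced from `det g ≠ 0`. -/
theorem Metric.map_comp_eq
    (hA : ∀ (p : M) (v w : TangentSpace (𝓡 n) p), (g.val p v w : ℂ) = ∑ I, A I p v * A I p w)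
    (x : Model n) :
    (Matrix.of fun i j => g.comp e i j x).map ((↑) : ℝ → ℂ)
      = (frame A e x).transpose * frame A e x := by
  ext a b
  rw [Matrix.mul_apply]
  exact hA (e.symm x) (coordVec e x a) (coordVec e x b)

theorem Metric.det_comp_ne_zero [IsManifold (𝓡 n) ∞ M] (hA : g.IsTakagiFactorization A)
    (he : IsChart e) {x : Model n} (hx : x ∈ e.target) :
    (Matrix.of fun i j => g.comp e i j x).det ≠ 0 := by
  intro h
  have h1 : ((Matrix.of fun i j => g.comp e i j x).map ((↑) : ℝ → ℂ)).det
      = (((Matrix.of fun i j => g.comp e i j x).det : ℝ) : ℂ) :=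
    (Complex.ofRealHom.map_det _).symm
  rw [Metric.map_comp_eq hA.factor, h, Matrix.det_mul, Matrix.det_transpose] at h1
  exact det_frame_ne_zero hA.linearIndependent he hx (by simpa using h1)

/-- With `F` the frame, `Fᵀ (F g⁻¹) = g g⁻¹ = 1`, and a right inverse of a square matrix is also a
left inverse. -/
theorem frame_mul_inv_mul_transpose [IsManifold (𝓡 n) ∞ M] (hA : g.IsTakagiFactorization A)
    (he : IsChart e) {x : Model n} (hx : x ∈ e.target) :
    frame A e x * ((Matrix.of fun i j => g.comp e i j x)⁻¹.map ((↑) : ℝ → ℂ)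
      * (frame A e x).transpose) = 1 := by
  rw [← Matrix.mul_assoc]
  refine mul_eq_one_comm.1 ?_
  rw [← Matrix.mul_assoc, ← Metric.map_comp_eq hA.factor]
  have h := Matrix.mul_nonsing_inv (Matrix.of fun i j => g.comp e i j x)
    (isUnit_iff_ne_zero.2 (Metric.det_comp_ne_zero hA he hx))
  have hmap := congrArg Complex.ofRealHom.mapMatrix h
  rw [map_mul, map_one] at hmap
  exact hmap

/-- The lowered Christoffel symbols of a closed factorization. -/
theorem lowered_christoffel_eq (hA : g.IsTakagiFactorization A) (hc : ∀ I, (A I).IsClosed)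
    (he : IsChart e) {x : Model n} (hx : x ∈ e.target) (a b d : Fin n) :
    (((1 / 2 : ℝ) * (partialDeriv a (g.comp e d b) x + partialDeriv b (g.comp e d a) x
      - partialDeriv d (g.comp e a b) x) : ℝ) : ℂ)
      = ((frame A e x).transpose * matDeriv a (frame A e) x) d b := by
  have hd : ∀ I a, DifferentiableAt ℝ ((A I).comp e a) x := fun I a =>
    differentiableAt_frame hA.smooth he hx I a
  have hg : ∀ c a b, ((partialDeriv c (g.comp e a b) x : ℝ) : ℂ)
      = ∑ I, (partialDeriv c ((A I).comp e a) x * (A I).comp e b x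
        + (A I).comp e a x * partialDeriv c ((A I).comp e b) x) := by
    intro c a b
    rw [← partialDeriv_ofReal ((g.contDiffAt_comp he hx a b).differentiableAt (by simp))]
    have h1 : (fun y => (g.comp e a b y : ℂ)) = fun y => ∑ I, (A I).comp e a y * (A I).comp e b y :=
      funext fun y => hA.factor _ _ _
    rw [h1, partialDeriv_sum fun I _ => (hd I a).fun_mul (hd I b)]
    exact Finset.sum_congr rfl fun I _ => partialDeriv_mul (hd I a) (hd I b)
  have hcl : ∀ I a b, partialDeriv a ((A I).comp e b) x = partialDeriv b ((A I).comp e a) x :=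
    fun I a b => sub_eq_zero.1 (hc I e he x hx a b)
  push_cast
  rw [hg, hg, hg, ← Finset.sum_add_distrib, ← Finset.sum_sub_distrib, Finset.mul_sum,
    Matrix.mul_apply]
  refine Finset.sum_congr rfl fun I _ => ?_
  have h1 : matDeriv a (frame A e) x I b = partialDeriv a ((A I).comp e b) x := rfl
  have h2 : (frame A e x).transpose d I = (A I).comp e d x := rfl
  -- Closedness is used in the direction that turns `∂_a A_d` and `∂_b A_d` into `d`-derivatives;
  -- these cancel against `∂_d g_{ab}`, and the two remaining terms coincide.
  rw [h1, h2, hcl I a d, hcl I b d, hcl I b a]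
  ring

/-- A closed factorization is parallel: `∂_a A_{Ib} = A_{Ic} Γ^c_{ab}`. -/
theorem matDeriv_frame [IsManifold (𝓡 n) ∞ M] (hA : g.IsTakagiFactorization A)
    (hc : ∀ I, (A I).IsClosed) (he : IsChart e) {x : Model n} (hx : x ∈ e.target) (a : Fin n) :
    matDeriv a (frame A e) x = frame A e x * connMatrix g e a x := by
  have h : connMatrix g e a x = (Matrix.of fun i j => g.comp e i j x)⁻¹.map ((↑) : ℝ → ℂ)
      * ((frame A e x).transpose * matDeriv a (frame A e) x) := by
    ext c b
    rw [Matrix.mul_apply]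
    simp only [connMatrix, Matrix.of_apply, Metric.christoffel, Complex.ofReal_sum,
      ← lowered_christoffel_eq hA hc he hx, Matrix.map_apply, Metric.invComp]
    exact Finset.sum_congr rfl fun d _ => Complex.ofReal_mul _ _
  rw [h, ← Matrix.mul_assoc _ _ (matDeriv a (frame A e) x), ← Matrix.mul_assoc,
    frame_mul_inv_mul_transpose hA he hx, Matrix.one_mul]

theorem Metric.contDiffAt_christoffel [IsManifold (𝓡 n) ∞ M] (hA : g.IsTakagiFactorization A)
    (he : IsChart e) {x : Model n} (hx : x ∈ e.target) (c a b : Fin n) :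
    ContDiffAt ℝ ∞ (g.christoffel e c a b) x := by
  have hp : ∀ c a b, ContDiffAt ℝ ∞ (partialDeriv c (g.comp e a b)) x := fun c a b =>
    (contDiffOn_partialDeriv e.open_target (g.smooth e he a b) c).contDiffAt
      (e.open_target.mem_nhds hx)
  refine ContDiffAt.sum fun d _ => ContDiffAt.mul
    (contDiffAt_matrix_inv (X := fun y => Matrix.of fun i j => g.comp e i j y)
      (fun i j => g.contDiffAt_comp he hx i j) (Metric.det_comp_ne_zero hA he hx) c d)
    (contDiffAt_const.mul (((hp _ _ _).add (hp _ _ _)).sub (hp _ _ _)))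

/-- A metric with a closed factorization is flat. -/
theorem Metric.isNonCurved_of_isClosed [IsManifold (𝓡 n) ∞ M] (hA : g.IsTakagiFactorization A)
    (hc : ∀ I, (A I).IsClosed) : g.IsNonCurved := by
  intro e he x hx a b c d
  refine Finset.sum_eq_zero fun k _ => mul_eq_zero_of_right _ ?_
  have hΓ : ∀ c i j, DifferentiableAt ℝ (fun y => connMatrix g e c y i j) x := by
    intro c i j
    exact Complex.ofRealCLM.differentiableAt.comp x
      ((Metric.contDiffAt_christoffel hA he hx i c j).differentiableAt (by simp))
  have h2 : ∀ c d, matDeriv c (matDeriv d (frame A e)) x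
      = frame A e x * (connMatrix g e c x * connMatrix g e d x + matDeriv c (connMatrix g e d) x) := by
    intro c d
    rw [matDeriv_congr (Y := fun y => frame A e y * connMatrix g e d y)
      (Filter.eventually_of_mem (e.open_target.mem_nhds hx) fun y hy =>
        matDeriv_frame hA hc he hy d),
      matDeriv_mul (differentiableAt_frame hA.smooth he hx) (hΓ d), matDeriv_frame hA hc he hx,
      Matrix.mul_add, Matrix.mul_assoc]
  have h3 : matDeriv c (matDeriv d (frame A e)) x = matDeriv d (matDeriv c (frame A e)) x := by
    ext I b
    exact partialDeriv_comm e.open_target (hA.smooth I e he b) c d hx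
  rw [h2, h2] at h3
  have hu := isUnit_iff_ne_zero.2 (det_frame_ne_zero hA.linearIndependent he hx)
  -- Cancelling the invertible frame leaves `Γ_c Γ_d + ∂_c Γ_d = Γ_d Γ_c + ∂_d Γ_c`, which is
  -- `R^k_{bcd} = 0` up to the order of the lower indices.
  have h4 := congrArg ((frame A e x)⁻¹ * ·) h3
  simp only [← Matrix.mul_assoc _ (frame A e x), Matrix.nonsing_inv_mul _ hu, Matrix.one_mul] at h4
  have h5 := congrFun (congrFun h4 k) b
  have hm : ∀ c d, matDeriv c (connMatrix g e d) x k b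
      = ((partialDeriv c (g.christoffel e k d b) x : ℝ) : ℂ) := fun c d =>
    partialDeriv_ofReal ((Metric.contDiffAt_christoffel hA he hx k d b).differentiableAt (by simp))
  simp only [Matrix.add_apply, Matrix.mul_apply, hm] at h5
  simp only [connMatrix, Matrix.of_apply] at h5
  norm_cast at h5
  have hs : ∀ c d, ∑ j, g.christoffel e k j c x * g.christoffel e j b d x
      = ∑ j, g.christoffel e k c j x * g.christoffel e j d b x := fun c d =>
    Finset.sum_congr rfl fun j _ => by rw [g.christoffel_symm e k j c, g.christoffel_symm e j b d]
  rw [Metric.curvatureUp, hs, hs, g.christoffel_symm e k b d, g.christoffel_symm e k b c]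
  linarith

end Frame

/-! ### Gluing local primitives on a simply connected space -/

section Gluing

/-- The complex numbers with the discrete topology. -/
structure DiscreteComplex where
  /-- the underlying complex number -/
  val : ℂ

/-- The discrete fibre turns the bundle below into a covering space, whose continuous sections have
locally constant fibre coordinate. -/
instance : TopologicalSpace DiscreteComplex := ⊥

instance : DiscreteTopology DiscreteComplex := ⟨rfl⟩

variable {X : Type*} [TopologicalSpace X]

/-- The bundle with discrete fibre whose local sections are the functions that differ from the
given local functions `f i` by locally constant ones. -/
def primitiveCore (U : X → Set X) (hU : ∀ i, IsOpen (U i)) (hmem : ∀ i, i ∈ U i) (f : X → X → ℂ)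
    (hf : ∀ i j, ∀ x ∈ U i ∩ U j, ∀ᶠ y in nhds x, f i y - f j y = f i x - f j x) :
    FiberBundleCore X X DiscreteComplex where
  baseSet := U
  isOpen_baseSet := hU
  indexAt := id
  mem_baseSet_at := hmem
  coordChange i j x v := ⟨v.val + (f i x - f j x)⟩
  coordChange_self i x _ v := by simp
  continuousOn_coordChange i j := by
    rintro ⟨x, v⟩ hx
    refine ContinuousAt.continuousWithinAt ?_
    refine (continuousAt_const (y := DiscreteComplex.mk (v.val + (f i x - f j x)))).congr ?_
    rw [nhds_prod_eq, nhds_discrete DiscreteComplex, Filter.prod_pure, Filter.EventuallyEq,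
      Filter.eventually_map]
    exact (hf i j x hx.1).mono fun y hy => by simp [hy]
  coordChange_comp i j k x _ v := by
    simp only [DiscreteComplex.mk.injEq]
    ring

/-- The total space of `primitiveCore` covers a simply connected, locally path connected base, so
the identity map lifts to a global section. Read in the trivialization over `U i`, the section is `φ
- f i`, which is locally constant. -/
theorem exists_glued_function [SimplyConnectedSpace X] [LocallyPathConnectedSpace X]
    (U : X → Set X) (hU : ∀ i, IsOpen (U i)) (hmem : ∀ i, i ∈ U i) (f : X → X → ℂ)
    (hf : ∀ i j, ∀ x ∈ U i ∩ U j, ∀ᶠ y in nhds x, f i y - f j y = f i x - f j x) :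
    ∃ φ : X → ℂ, ∀ i, ∀ x ∈ U i, ∀ᶠ y in nhds x, φ y - f i y = φ x - f i x := by
  let Z := primitiveCore U hU hmem f hf
  have hcov : IsCoveringMap Z.proj := FiberBundle.isCoveringMap (F := DiscreteComplex) (E := Z.Fiber)
  obtain ⟨x₀⟩ := (inferInstance : Nonempty X)
  obtain ⟨s, ⟨-, hs⟩, -⟩ := hcov.existsUnique_continuousMap_lifts (ContinuousMap.id X) x₀
    (⟨x₀, DiscreteComplex.mk 0⟩ : Z.TotalSpace) rfl
  have hs' : ∀ y, (s y).1 = y := fun y => congrFun hs y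
  -- The preferred trivialization at `y` has index `y`, so the fibre coordinate of `s y` is the
  -- constant to be added to `f y` at `y`.
  refine ⟨fun y => f (s y).1 (s y).1 + DiscreteComplex.val (s y).2, fun i x hx => ?_⟩
  have hmemS : s x ∈ (Z.localTriv i).source := by
    rw [Z.mem_localTriv_source, hs' x]
    exact hx
  have hc : ContinuousAt (fun y => (Z.localTriv i (s y)).2) x :=
    continuousAt_snd.comp (((Z.localTriv i).toOpenPartialHomeomorph.continuousAt hmemS).comp
      s.continuous.continuousAt)
  have he : ∀ᶠ y in nhds x, (Z.localTriv i (s y)).2 = (Z.localTriv i (s x)).2 := by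
    have h1 := hc.tendsto
    rw [nhds_discrete DiscreteComplex, Filter.tendsto_pure] at h1
    exact h1
  have key : ∀ y, DiscreteComplex.val (Z.localTriv i (s y)).2
      = f (s y).1 (s y).1 + DiscreteComplex.val (s y).2 - f i y := by
    intro y
    have h1 : DiscreteComplex.val (Z.localTriv i (s y)).2
      = DiscreteComplex.val (s y).2 + (f (s y).1 (s y).1 - f i (s y).1) := rfl
    have h2 : f i (s y).1 = f i y := by rw [hs' y]
    rw [h1, h2]
    ring
  filter_upwards [he] with y hy
  rw [← key y, ← key x, hy]

end Gluing

section Primitive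

variable {n : ℕ} {M : Type*} [TopologicalSpace M] [ChartedSpace (Model n) M]
  {e : OpenPartialHomeomorph M (Model n)} {A : OneForm n M}

/-! ### Local primitives of closed forms -/

theorem OneForm.contDiffOn_pullback (hA : A.IsSmooth) (he : IsChart e) :
    ContDiffOn ℝ ∞ (A.pullback e) e.target := by
  rw [contDiffOn_clm_apply]
  intro v
  simp only [OneForm.pullback_apply]
  exact ContDiffOn.sum fun a _ => (hA e he a).const_smul _

/-- This is `dA = 0` in the coordinate-free form that the Poincaré lemma on convex sets requires. -/
theorem OneForm.fderiv_pullback_symm (hA : A.IsSmooth) (hc : A.IsClosed) (he : IsChart e)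
    {x : Model n} (hx : x ∈ e.target) (u v : Model n) :
    fderiv ℝ (A.pullback e) x u v = fderiv ℝ (A.pullback e) x v u := by
  have hd : DifferentiableAt ℝ (A.pullback e) x :=
    ((A.contDiffOn_pullback hA he).contDiffAt (e.open_target.mem_nhds hx)).differentiableAt
      (by simp)
  have hda : ∀ a, DifferentiableAt ℝ (A.comp e a) x := fun a =>
    ((hA e he a).contDiffAt (e.open_target.mem_nhds hx)).differentiableAt (by simp)
  have key : ∀ u v : Model n, fderiv ℝ (A.pullback e) x u v
      = ∑ a, ∑ b, u a • v b • partialDeriv a (A.comp e b) x := by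
    intro u v
    have h : HasFDerivAt (fun y => A.pullback e y v)
        ((fderiv ℝ (A.pullback e) x).flip v) x := by
      simpa using hd.hasFDerivAt.clm_apply (hasFDerivAt_const v x)
    have h1 : fderiv ℝ (A.pullback e) x u v = fderiv ℝ (fun y => A.pullback e y v) x u := by
      rw [h.fderiv]; rfl
    rw [h1, fderiv_eq_sum_partialDeriv]
    refine Finset.sum_congr rfl fun a _ => ?_
    rw [← Finset.smul_sum]
    congr 1
    simp only [OneForm.pullback_apply]
    rw [partialDeriv_sum fun b _ => (hda b).fun_const_smul (v b)]
    refine Finset.sum_congr rfl fun b _ => ?_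
    simp only [partialDeriv, fderiv_fun_const_smul (hda b)]
    rfl
  rw [key, key, Finset.sum_comm]
  refine Finset.sum_congr rfl fun a _ => Finset.sum_congr rfl fun b _ => ?_
  rw [sub_eq_zero.1 (hc e he x hx b a), smul_comm]

/-- A closed form has a smooth primitive on every ball of a chart. -/
theorem OneForm.exists_primitive_on_ball (hA : A.IsSmooth) (hc : A.IsClosed) (he : IsChart e)
    {x₀ : Model n} {r : ℝ} (hr : Metric.ball x₀ r ⊆ e.target) :
    ∃ f : Model n → ℂ, ContDiffOn ℝ ∞ f (Metric.ball x₀ r) ∧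
      ∀ x ∈ Metric.ball x₀ r, HasFDerivAt f (A.pullback e x) x := by
  have hω := (A.contDiffOn_pullback hA he).mono hr
  obtain ⟨f, hf⟩ := (convex_ball x₀ r).exists_forall_hasFDerivAt_of_fderiv_symmetric
    Metric.isOpen_ball (hω.differentiableOn (by simp))
    fun x hx u v => A.fderiv_pullback_symm hA hc he (hr hx) u v
  refine ⟨f, ?_, hf⟩
  -- The primitive is only known to be differentiable; it is smooth because its derivative is the
  -- smooth form.
  rw [contDiffOn_infty_iff_fderiv_of_isOpen Metric.isOpen_ball]
  exact ⟨fun x hx => (hf x hx).differentiableAt.differentiableWithinAt,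
    hω.congr fun x hx => (hf x hx).fderiv⟩

theorem OneForm.pullback_mfderiv [IsManifold (𝓡 n) ∞ M] (A : OneForm n M) (he : IsChart e)
    {p : M} (hp : p ∈ e.source) :
    ((A.pullback e (e p)).comp (mfderiv (𝓡 n) (𝓡 n) e p) : TangentSpace (𝓡 n) p →L[ℝ] ℂ) = A p := by
  have : IsManifold (𝓡 n) 1 M := IsManifold.of_le (n := ∞) (by simp)
  have h1 := he.mdifferentiable.symm_comp_deriv hp
  have h2 : ∀ q, q = p → ∀ v : Model n, (show Model n →L[ℝ] ℂ from A q) v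
      = (show Model n →L[ℝ] ℂ from A p) v := by
    rintro q rfl v; rfl
  ext v
  refine (h2 _ (e.left_inv hp) _).trans ?_
  exact congrArg (A p) (congrArg (fun L : TangentSpace (𝓡 n) p →L[ℝ] TangentSpace (𝓡 n) p => L v) h1)

theorem OneForm.exists_local_primitive [IsManifold (𝓡 n) ∞ M] (hA : A.IsSmooth)
    (hc : A.IsClosed) (p : M) :
    ∃ (U : Set M) (f : M → ℂ), IsOpen U ∧ p ∈ U ∧ ContMDiffOn (𝓡 n) 𝓘(ℝ, ℂ) ∞ f U ∧
      ∀ q ∈ U, HasMFDerivAt (𝓡 n) 𝓘(ℝ, ℂ) f q (A q) := by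
  set e := chartAt (Model n) p
  have he : IsChart e := IsManifold.chart_mem_maximalAtlas p
  have hp : p ∈ e.source := mem_chart_source _ p
  obtain ⟨r, hr0, hr⟩ := Metric.isOpen_iff.1 e.open_target (e p) (e.map_source hp)
  obtain ⟨f, hf, hf'⟩ := A.exists_primitive_on_ball hA hc he hr
  refine ⟨e.source ∩ e ⁻¹' Metric.ball (e p) r, f ∘ e, e.isOpen_inter_preimage Metric.isOpen_ball,
    ⟨hp, Metric.mem_ball_self hr0⟩, ?_, ?_⟩
  · exact hf.contMDiffOn.comp ((contMDiffOn_of_mem_maximalAtlas he).mono Set.inter_subset_left)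
      fun q hq => hq.2
  · intro q hq
    have h := (hf' (e q) hq.2).hasMFDerivAt.comp q
      (he.mdifferentiable.mdifferentiableAt hq.1).hasMFDerivAt
    have h2 := A.pullback_mfderiv he hq.1
    rw [← h2]
    exact h

theorem eventually_eq_of_hasMFDerivAt_zero [IsManifold (𝓡 n) ∞ M] {F : Type*}
    [NormedAddCommGroup F] [NormedSpace ℝ F] {f : M → F} {U : Set M} (hU : IsOpen U)
    (hf : ∀ q ∈ U, HasMFDerivAt (𝓡 n) 𝓘(ℝ, F) f q
      (0 : TangentSpace (𝓡 n) q →L[ℝ] TangentSpace 𝓘(ℝ, F) (f q)))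
    {p : M} (hp : p ∈ U) : ∀ᶠ q in nhds p, f q = f p := by
  set e := chartAt (Model n) p
  have he : IsChart e := IsManifold.chart_mem_maximalAtlas p
  have hpe : p ∈ e.source := mem_chart_source _ p
  set V := e.target ∩ e.symm ⁻¹' U
  have hV : IsOpen V := e.isOpen_inter_preimage_symm hU
  have hd : ∀ x ∈ V, HasFDerivAt (f ∘ e.symm) (0 : Model n →L[ℝ] F) x := by
    intro x hx
    have h := (hf _ hx.2).comp x (he.mdifferentiable.mdifferentiableAt_symm hx.1).hasMFDerivAt
    have h2 := h.hasFDerivAt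
    have h3 : ((0 : TangentSpace (𝓡 n) (e.symm x) →L[ℝ] F).comp
        (mfderiv (𝓡 n) (𝓡 n) e.symm x) : Model n →L[ℝ] F) = 0 := by
      ext v
      rfl
    exact h3 ▸ h2
  -- With zero derivative, the level set through `p` is open in the chart, so no connected
  -- neighbourhood has to be chosen.
  have ho := hV.isOpen_inter_preimage_of_fderiv_eq_zero
    (fun x hx => (hd x hx).differentiableAt.differentiableWithinAt) (fun x hx => (hd x hx).fderiv)
    {f p}
  have h0 : e p ∈ V ∩ (f ∘ e.symm) ⁻¹' {f p} := by
    refine ⟨⟨e.map_source hpe, ?_⟩, ?_⟩ <;> simp [e.left_inv hpe, hp]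
  filter_upwards [(e.continuousAt hpe).preimage_mem_nhds (ho.mem_nhds h0),
    e.open_source.mem_nhds hpe] with q hq hqe
  simpa [e.left_inv hqe] using hq.2

/-- On a simply connected manifold closed 1-forms are exact. -/
theorem OneForm.isExact_of_isClosed [IsManifold (𝓡 n) ∞ M] [SimplyConnectedSpace M]
    (hA : A.IsSmooth) (hc : A.IsClosed) : A.IsExact := by
  have : LocallyPathConnectedSpace M := ChartedSpace.locallyPathConnectedSpace (Model n) M
  choose U f hU hmem hf hf' using A.exists_local_primitive hA hc
  have hloc : ∀ i j, ∀ x ∈ U i ∩ U j, ∀ᶠ y in nhds x, f i y - f j y = f i x - f j x := by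
    intro i j x hx
    refine eventually_eq_of_hasMFDerivAt_zero (n := n) (f := fun y => f i y - f j y)
      ((hU i).inter (hU j)) (fun q hq => ?_) hx
    have h := (hf' i q hq.1).sub (hf' j q hq.2)
    rwa [show A q - A q = 0 from sub_self (A q)] at h
  obtain ⟨φ, hφ⟩ := exists_glued_function U hU hmem f hloc
  have hev : ∀ p, φ =ᶠ[nhds p] fun y => f p y + (φ p - f p p) := fun p =>
    (hφ p p (hmem p)).mono fun y hy => by rw [← hy]; ring
  refine ⟨φ, fun p => ?_, fun p v => ?_⟩
  · exact (((hf p).contMDiffAt ((hU p).mem_nhds (hmem p))).add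
      contMDiffAt_const).congr_of_eventuallyEq (hev p)
  · have h1 := ((hf' p p (hmem p)).add (hasMFDerivAt_const (φ p - f p p) p)).congr_of_eventuallyEq
      (hev p)
    rw [h1.mfderiv]
    exact congrArg (fun L : TangentSpace (𝓡 n) p →L[ℝ] ℂ => L v) (add_zero (A p)).symm

end Primitive

section Global

variable {n : ℕ} {M : Type*} [TopologicalSpace M] [ChartedSpace (Model n) M]
  {e : OpenPartialHomeomorph M (Model n)} {g : Metric n M} {A B : Fin n → OneForm n M}

/-! ### Exact forms -/

variable (n) in
/-- The differential of a complex function, as a 1-form. -/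
def OneForm.differential (φ : M → ℂ) : OneForm n M :=
  fun p => mfderiv (𝓡 n) 𝓘(ℝ, ℂ) φ p

theorem OneForm.isExact_differential {φ : M → ℂ} (hφ : ContMDiff (𝓡 n) 𝓘(ℝ, ℂ) ∞ φ) :
    (OneForm.differential n φ).IsExact :=
  ⟨φ, hφ, fun _ _ => rfl⟩

theorem contDiffOn_comp_symm {F : Type*} [NormedAddCommGroup F] [NormedSpace ℝ F] {φ : M → F}
    (hφ : ContMDiff (𝓡 n) 𝓘(ℝ, F) ∞ φ) (he : IsChart e) :
    ContDiffOn ℝ ∞ (φ ∘ e.symm) e.target :=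
  (hφ.comp_contMDiffOn (contMDiffOn_symm_of_mem_maximalAtlas he)).contDiffOn

theorem OneForm.comp_differential {φ : M → ℂ} (hφ : ContMDiff (𝓡 n) 𝓘(ℝ, ℂ) ∞ φ)
    (he : IsChart e) {x : Model n} (hx : x ∈ e.target) (a : Fin n) :
    (OneForm.differential n φ).comp e a x = partialDeriv a (φ ∘ e.symm) x := by
  have h := mfderiv_comp x (hφ.mdifferentiableAt (by simp))
    (he.mdifferentiable.mdifferentiableAt_symm hx)
  rw [mfderiv_eq_fderiv] at h
  rw [partialDeriv, h]
  rfl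

theorem OneForm.isSmooth_differential {φ : M → ℂ} (hφ : ContMDiff (𝓡 n) 𝓘(ℝ, ℂ) ∞ φ) :
    (OneForm.differential n φ).IsSmooth := fun e he a =>
  (contDiffOn_partialDeriv e.open_target (contDiffOn_comp_symm hφ he) a).congr fun _ hx =>
    OneForm.comp_differential hφ he hx a

theorem OneForm.isClosed_differential {φ : M → ℂ} (hφ : ContMDiff (𝓡 n) 𝓘(ℝ, ℂ) ∞ φ) :
    (OneForm.differential n φ).IsClosed := by
  intro e he x hx a b
  have h : ∀ a b, partialDeriv a ((OneForm.differential n φ).comp e b) x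
      = partialDeriv a (partialDeriv b (φ ∘ e.symm)) x := fun a b =>
    partialDeriv_congr (Filter.eventually_of_mem (e.open_target.mem_nhds hx) fun y hy =>
      OneForm.comp_differential hφ he hy b)
  rw [OneForm.extDerivComp, h, h,
    partialDeriv_comm e.open_target (contDiffOn_comp_symm hφ he) a b hx, sub_self]

theorem OneForm.isExact_zero : (0 : OneForm n M).IsExact :=
  ⟨fun _ => 0, contMDiff_const, fun p v => by rw [mfderiv_const]; rfl⟩

theorem OneForm.IsExact.add {α β : OneForm n M} (hα : α.IsExact) (hβ : β.IsExact) :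
    (α + β).IsExact := by
  obtain ⟨φ, hφ, h⟩ := hα
  obtain ⟨ψ, hψ, h'⟩ := hβ
  refine ⟨φ + ψ, hφ.add hψ, fun p v => ?_⟩
  rw [mfderiv_add (hφ.mdifferentiableAt (by simp)) (hψ.mdifferentiableAt (by simp))]
  exact congrArg₂ (· + ·) (h p v) (h' p v)

theorem OneForm.IsExact.const_smul {α : OneForm n M} (hα : α.IsExact) (c : ℂ) :
    (c • α).IsExact := by
  obtain ⟨φ, hφ, h⟩ := hα
  let L : ℂ →L[ℝ] ℂ := ContinuousLinearMap.mul ℝ ℂ c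
  refine ⟨L ∘ φ, L.contMDiff.comp hφ, fun p v => ?_⟩
  rw [mfderiv_comp p L.mdifferentiableAt (hφ.mdifferentiableAt (by simp)),
    ContinuousLinearMap.mfderiv_eq]
  exact congrArg (c * ·) (h p v)

theorem OneForm.isExact_sum {ι : Type*} (s : Finset ι) (α : ι → OneForm n M)
    (h : ∀ i, (α i).IsExact) : (∑ i ∈ s, α i).IsExact :=
  Finset.sum_induction α OneForm.IsExact (fun _ _ => OneForm.IsExact.add) OneForm.isExact_zero
    fun i _ => h i

/-! ### Comparison of parallel coframes -/

theorem frame_eq_mul {O : Matrix (Fin n) (Fin n) ℂ} {p : M} (hp : p ∈ e.source)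
    (h : ∀ I, A I p = ∑ J, O I J • B J p) : frame A e (e p) = O * frame B e (e p) := by
  have h' : ∀ I, A I (e.symm (e p)) = ∑ J, O I J • B J (e.symm (e p)) := by
    rwa [e.left_inv hp]
  ext I a
  rw [Matrix.mul_apply]
  change A I (e.symm (e p)) (coordVec e (e p) a) = _
  rw [h' I, sum_apply]
  rfl

theorem eq_sum_of_frame_eq [IsManifold (𝓡 n) ∞ M] (he : IsChart e)
    {O : Matrix (Fin n) (Fin n) ℂ} {p : M} (hp : p ∈ e.source)
    (h : frame A e (e p) = O * frame B e (e p)) (I : Fin n) : A I p = ∑ J, O I J • B J p := by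
  have key : ∀ w : Model n, (A I).pullback e (e p) w
      = ∑ J, O I J * (B J).pullback e (e p) w := by
    intro w
    simp only [OneForm.pullback_apply, Finset.mul_sum]
    rw [Finset.sum_comm]
    refine Finset.sum_congr rfl fun a _ => ?_
    have h1 : (A I).comp e a (e p) = ∑ J, O I J * (B J).comp e a (e p) :=
      congrFun (congrFun h I) a
    simp [h1, Finset.mul_sum, mul_left_comm]
  have hpull : ∀ (C : OneForm n M) (v : TangentSpace (𝓡 n) p),
      C p v = C.pullback e (e p) (mfderiv (𝓡 n) (𝓡 n) e p v) := fun C v =>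
    congrArg (fun L : TangentSpace (𝓡 n) p →L[ℝ] ℂ => L v) (C.pullback_mfderiv he hp).symm
  ext v
  refine (hpull (A I) v).trans ((key _).trans ?_)
  rw [sum_apply]
  exact Finset.sum_congr rfl fun J _ => congrArg (O I J * ·) (hpull (B J) v).symm

theorem linearIndependent_of_det_frame_ne_zero {p : M} (hp : p ∈ e.source)
    (h : (frame B e (e p)).det ≠ 0) : LinearIndependent ℂ fun I => B I p := by
  rw [Fintype.linearIndependent_iff]
  intro c hc
  have h' : ∑ J, c J • B J (e.symm (e p)) = 0 := by rwa [e.left_inv hp]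
  refine congrFun (Matrix.eq_zero_of_vecMul_eq_zero h (funext fun a => ?_))
  have h1 := congrArg (fun L : TangentSpace (𝓡 n) (e.symm (e p)) →L[ℝ] ℂ =>
    L (coordVec e (e p) a)) h'
  simp only [sum_apply] at h1
  exact h1

/-- Two coframes on a connected manifold that are parallel for the same connection differ by a
constant matrix. -/
theorem exists_const_matrix_of_parallel [IsManifold (𝓡 n) ∞ M] [ConnectedSpace M]
    (hA : ∀ I, (A I).IsSmooth) (hB : ∀ I, (B I).IsSmooth)
    (hBli : ∀ p, LinearIndependent ℂ fun I => B I p)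
    (h : ∀ p : M, ∃ e : OpenPartialHomeomorph M (Model n), IsChart e ∧ p ∈ e.source ∧
      ∀ x ∈ e.target, ∃ Γ : Fin n → Matrix (Fin n) (Fin n) ℂ,
        (∀ a, matDeriv a (frame A e) x = frame A e x * Γ a) ∧
        (∀ a, matDeriv a (frame B e) x = frame B e x * Γ a)) :
    ∃ O : Matrix (Fin n) (Fin n) ℂ, ∀ I, A I = ∑ J, O I J • B J := by
  have hdet : ∀ {e : OpenPartialHomeomorph M (Model n)}, IsChart e → ∀ {q : M}, q ∈ e.source →
      IsUnit (frame B e (e q)).det := fun he _ hq =>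
    isUnit_iff_ne_zero.2 (det_frame_ne_zero hBli he (OpenPartialHomeomorph.map_source _ hq))
  have hex : ∀ p : M, ∃ O : Matrix (Fin n) (Fin n) ℂ, ∀ I, A I p = ∑ J, O I J • B J p := by
    intro p
    have he : IsChart (chartAt (Model n) p) := IsManifold.chart_mem_maximalAtlas p
    have hp := mem_chart_source (Model n) p
    refine ⟨frame A (chartAt _ p) (chartAt _ p p) * (frame B (chartAt _ p) (chartAt _ p p))⁻¹,
      eq_sum_of_frame_eq he hp ?_⟩
    rw [Matrix.mul_assoc, Matrix.nonsing_inv_mul _ (hdet he hp), Matrix.mul_one]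
  choose O hO using hex
  -- The matrix at each point is unique because the second frame is invertible. The pointwise
  -- choices therefore agree with `F G⁻¹` computed in any chart, and there its derivative vanishes.
  have hloc : IsLocallyConstant O := by
    rw [IsLocallyConstant.iff_eventually_eq]
    intro p
    obtain ⟨e, he, hp, hΓ⟩ := h p
    have hOe : ∀ q ∈ e.source, O q = frame A e (e q) * (frame B e (e q))⁻¹ := by
      intro q hq
      rw [frame_eq_mul hq (hO q), Matrix.mul_assoc, Matrix.mul_nonsing_inv _ (hdet he hq),
        Matrix.mul_one]
    have hz : ∀ i j, ∀ x ∈ e.target,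
        DifferentiableAt ℝ (fun y => (frame A e y * (frame B e y)⁻¹) i j) x ∧
        fderiv ℝ (fun y => (frame A e y * (frame B e y)⁻¹) i j) x = 0 := by
      intro i j x hx
      obtain ⟨Γ, h1, h2⟩ := hΓ x hx
      have hd := det_frame_ne_zero hBli he hx
      refine ⟨?_, fderiv_mul_inv_eq_zero (contDiffAt_frame hA he hx) (contDiffAt_frame hB he hx)
        hd h1 h2 i j⟩
      simp only [Matrix.mul_apply]
      exact DifferentiableAt.fun_sum fun k _ => (differentiableAt_frame hA he hx i k).fun_mul
        ((contDiffAt_matrix_inv (contDiffAt_frame hB he hx) hd k j).differentiableAt (by simp))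
    have hev : ∀ i j, ∀ᶠ q in nhds p, O q i j = O p i j := by
      intro i j
      have ho := e.open_target.isOpen_inter_preimage_of_fderiv_eq_zero
        (fun x hx => (hz i j x hx).1.differentiableWithinAt) (fun x hx => (hz i j x hx).2)
        {O p i j}
      have h0 : e p ∈ e.target ∩ (fun y => (frame A e y * (frame B e y)⁻¹) i j) ⁻¹' {O p i j} :=
        ⟨e.map_source hp, by rw [hOe p hp]; rfl⟩
      filter_upwards [(e.continuousAt hp).preimage_mem_nhds (ho.mem_nhds h0),
        e.open_source.mem_nhds hp] with q hq hqe
      rw [hOe q hqe]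
      exact hq.2
    filter_upwards [Filter.eventually_all.2 fun i => Filter.eventually_all.2 (hev i)] with q hq
    ext i j
    exact hq i j
  obtain ⟨p₀⟩ := (inferInstance : Nonempty M)
  refine ⟨O p₀, fun I => funext fun p => ?_⟩
  rw [hO p I, hloc.apply_eq_of_preconnectedSpace p p₀, Finset.sum_apply]
  rfl

/-- A coframe that is parallel for the same connection as an exact coframe is exact. -/
theorem isExact_of_parallel [IsManifold (𝓡 n) ∞ M] [ConnectedSpace M]
    (hA : ∀ I, (A I).IsSmooth) {ψ : Fin n → M → ℂ}
    (hψ : ∀ I, ContMDiff (𝓡 n) 𝓘(ℝ, ℂ) ∞ (ψ I))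
    (hli : ∀ p, LinearIndependent ℂ fun I => OneForm.differential n (ψ I) p)
    (h : ∀ p : M, ∃ e : OpenPartialHomeomorph M (Model n), IsChart e ∧ p ∈ e.source ∧
      ∀ x ∈ e.target, ∃ Γ : Fin n → Matrix (Fin n) (Fin n) ℂ,
        (∀ a, matDeriv a (frame A e) x = frame A e x * Γ a) ∧
        (∀ a, matDeriv a (frame (fun I => OneForm.differential n (ψ I)) e) x
          = frame (fun I => OneForm.differential n (ψ I)) e x * Γ a)) (I : Fin n) :
    (A I).IsExact := by
  obtain ⟨O, hO⟩ := exists_const_matrix_of_parallel hA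
    (fun I => OneForm.isSmooth_differential (hψ I)) hli h
  rw [hO I]
  exact OneForm.isExact_sum _ _ fun J => (OneForm.isExact_differential (hψ J)).const_smul _

/-! ### Cartesian-like metrics -/

/-- Complex square roots absorb the signs: the forms `√ε_a dφ_a` are an exact factorization of `g`,
hence parallel for its Levi-Civita connection. -/
theorem Metric.isExact_of_isGloballyCartesian [IsManifold (𝓡 n) ∞ M] [ConnectedSpace M]
    (hA : g.IsTakagiFactorization A) (hc : ∀ I, (A I).IsClosed) (hg : g.IsGloballyCartesian)
    (I : Fin n) : (A I).IsExact := by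
  obtain ⟨ε, φ, hε, hφ, hgφ⟩ := hg
  have hroot : ∀ a, ∃ c : ℂ, c * c = ε a := by
    intro a
    rcases hε a with h | h
    · exact ⟨1, by simp [h]⟩
    · exact ⟨Complex.I, by simp [h]⟩
  choose c hcε using hroot
  let L : Fin n → ℝ →L[ℝ] ℂ := fun a => ContinuousLinearMap.toSpanSingleton ℝ (c a)
  let ψ : Fin n → M → ℂ := fun a => L a ∘ φ a
  have hψ : ∀ a, ContMDiff (𝓡 n) 𝓘(ℝ, ℂ) ∞ (ψ a) := fun a => (L a).contMDiff.comp (hφ a)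
  let B : Fin n → OneForm n M := fun a => OneForm.differential n (ψ a)
  have hBφ : ∀ a p (v : TangentSpace (𝓡 n) p), B a p v
      = ((show ℝ from mfderiv (𝓡 n) 𝓘(ℝ, ℝ) (φ a) p v : ℝ) : ℂ) * c a := by
    intro a p v
    change mfderiv (𝓡 n) 𝓘(ℝ, ℂ) (L a ∘ φ a) p v = _
    rw [mfderiv_comp p (L a).mdifferentiableAt ((hφ a).mdifferentiableAt (by simp)),
      ContinuousLinearMap.mfderiv_eq]
    rfl
  have hfac : ∀ (p : M) (v w : TangentSpace (𝓡 n) p),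
      (g.val p v w : ℂ) = ∑ I, B I p v * B I p w := by
    intro p v w
    rw [hgφ p v w, Complex.ofReal_sum]
    refine Finset.sum_congr rfl fun a _ => ?_
    rw [hBφ, hBφ, Complex.ofReal_mul, Complex.ofReal_mul, ← hcε a]
    ring
  have hli : ∀ p, LinearIndependent ℂ fun I => B I p := by
    intro p
    have he : IsChart (chartAt (Model n) p) := IsManifold.chart_mem_maximalAtlas p
    have hp := mem_chart_source (Model n) p
    refine linearIndependent_of_det_frame_ne_zero hp fun h0 => ?_
    have h1 := congrArg Matrix.det
      (Metric.map_comp_eq (e := chartAt (Model n) p) hfac (chartAt (Model n) p p))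
    rw [Matrix.det_mul, h0, mul_zero] at h1
    refine Metric.det_comp_ne_zero hA he ((chartAt (Model n) p).map_source hp) ?_
    exact Complex.ofReal_eq_zero.1 ((Complex.ofRealHom.map_det _).trans h1)
  have hB : g.IsTakagiFactorization B :=
    ⟨fun a => OneForm.isSmooth_differential (hψ a), hli, hfac⟩
  refine isExact_of_parallel hA.smooth hψ hli (fun p => ⟨chartAt (Model n) p,
    IsManifold.chart_mem_maximalAtlas p, mem_chart_source _ p, fun x hx => ?_⟩) I
  have he : IsChart (chartAt (Model n) p) := IsManifold.chart_mem_maximalAtlas p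
  exact ⟨fun a => connMatrix g _ a x, matDeriv_frame hA hc he hx,
    matDeriv_frame hB (fun a => OneForm.isClosed_differential (hψ a)) he hx⟩

/-! ### Global coordinates with vanishing connection -/

theorem IsGlobalCoordinates.contMDiff {y : M → Model n} (hy : IsGlobalCoordinates y) :
    ContMDiff (𝓡 n) 𝓘(ℝ, Model n) ∞ y := by
  intro p
  obtain ⟨e, he, hp, hye⟩ := hy p
  exact (contMDiffAt_of_mem_maximalAtlas he hp).congr_of_eventuallyEq
    (Filter.eventually_of_mem (e.open_source.mem_nhds hp) hye)

theorem Metric.isExact_of_connectionNullIn [IsManifold (𝓡 n) ∞ M] [ConnectedSpace M]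
    (hA : g.IsTakagiFactorization A) (hc : ∀ I, (A I).IsClosed) {y : M → Model n}
    (hy : IsGlobalCoordinates y) (hnull : g.ConnectionNullIn y) (I : Fin n) :
    (A I).IsExact := by
  let L : Fin n → Model n →L[ℝ] ℂ := fun a => Complex.ofRealCLM.comp (EuclideanSpace.proj a)
  let ψ : Fin n → M → ℂ := fun a => L a ∘ y
  have hψ : ∀ a, ContMDiff (𝓡 n) 𝓘(ℝ, ℂ) ∞ (ψ a) := fun a => (L a).contMDiff.comp hy.contMDiff
  -- In a chart that agrees with `y`, the coframe `dy_a` has the identity as its matrix. It is thus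
  -- parallel for `Γ = 0`.
  have hframe : ∀ e : OpenPartialHomeomorph M (Model n), IsChart e → Set.EqOn y e e.source →
      ∀ x ∈ e.target, frame (fun I => OneForm.differential n (ψ I)) e x = 1 := by
    intro e he hye x hx
    ext J a
    change (OneForm.differential n (ψ J)).comp e a x = _
    have hev : ψ J ∘ e.symm =ᶠ[nhds x] L J :=
      Filter.eventually_of_mem (e.open_target.mem_nhds hx) fun z hz => by
        simp only [ψ, Function.comp_apply, hye (e.map_target hz), e.right_inv hz]
    rw [OneForm.comp_differential (hψ J) he hx, partialDeriv_congr hev, partialDeriv,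
      ContinuousLinearMap.fderiv]
    by_cases h : J = a <;> simp [L, stdVec, Matrix.one_apply, h]
  refine isExact_of_parallel hA.smooth hψ (fun p => ?_) (fun p => ?_) I
  · obtain ⟨e, he, hp, hye⟩ := hy p
    refine linearIndependent_of_det_frame_ne_zero hp ?_
    rw [hframe e he hye _ (e.map_source hp), Matrix.det_one]
    exact one_ne_zero
  · obtain ⟨e, he, hp, hye⟩ := hy p
    refine ⟨e, he, hp, fun x hx => ⟨fun _ => 0, fun a => ?_, fun a => ?_⟩⟩
    · rw [matDeriv_frame hA hc he hx]
      congr 1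
      ext c b
      simp [connMatrix, hnull e he hye x hx]
    · rw [Matrix.mul_zero, matDeriv_congr (Y := fun _ => 1)
        (Filter.eventually_of_mem (e.open_target.mem_nhds hx) (hframe e he hye))]
      ext i j
      exact partialDeriv_const _ _ _

end Global

section Geodesics

variable {n : ℕ} {M : Type*} [TopologicalSpace M] [ChartedSpace (Model n) M]
  {e : OpenPartialHomeomorph M (Model n)} {g : Metric n M} {A : Fin n → OneForm n M}

/-! ### Geodesics of a closed factorization -/

/-- The value of a 1-form on the velocity of a curve, computed in a chart. -/
theorem OneForm.apply_velocity [IsManifold (𝓡 n) ∞ M] (α : OneForm n M) (he : IsChart e)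
    {γ : ℝ → M} {t : ℝ} (hγ : MDifferentiableAt 𝓘(ℝ, ℝ) (𝓡 n) γ t) (ht : γ t ∈ e.source) :
    α (γ t) (mfderiv 𝓘(ℝ, ℝ) (𝓡 n) γ t (1 : ℝ))
      = α.pullback e (e (γ t)) (deriv (fun t => e (γ t)) t) := by
  have h1 := mfderiv_comp t (he.mdifferentiable.mdifferentiableAt ht) hγ
  rw [mfderiv_eq_fderiv] at h1
  have h2 : deriv (fun t => e (γ t)) t
      = mfderiv (𝓡 n) (𝓡 n) e (γ t) (mfderiv 𝓘(ℝ, ℝ) (𝓡 n) γ t (1 : ℝ)) := by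
    rw [← fderiv_apply_one_eq_deriv]
    exact congrArg (fun L : ℝ →L[ℝ] Model n => L 1) h1
  have h3 := congrArg (fun L : TangentSpace (𝓡 n) (γ t) →L[ℝ] ℂ =>
    L (mfderiv 𝓘(ℝ, ℝ) (𝓡 n) γ t (1 : ℝ))) (α.pullback_mfderiv he ht)
  rw [h2]
  exact h3.symm

theorem hasDerivAt_comp_partialDeriv {f : Model n → ℂ} {u : ℝ → Model n} {u' : Model n} {s : ℝ}
    (hf : DifferentiableAt ℝ f (u s)) (hu : HasDerivAt u u' s) :
    HasDerivAt (fun t => f (u t)) (∑ b, (u' b : ℂ) * partialDeriv b f (u s)) s := by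
  have h := hf.hasFDerivAt.comp_hasDerivAt s hu
  rw [fderiv_eq_sum_partialDeriv] at h
  exact h

/-- A curve along which the forms of a closed factorization take constant values on the velocity
is a geodesic. -/
theorem Metric.isGeodesicOn_of_velocity [IsManifold (𝓡 n) ∞ M] (hA : g.IsTakagiFactorization A)
    (hc : ∀ I, (A I).IsClosed) {γ : ℝ → M} {s₀ s₁ : ℝ}
    (hγ : ContMDiffOn 𝓘(ℝ, ℝ) (𝓡 n) ∞ γ (Set.Ioo s₀ s₁)) {k : Fin n → ℂ}
    (hk : ∀ t ∈ Set.Ioo s₀ s₁, ∀ I, A I (γ t) (mfderiv 𝓘(ℝ, ℝ) (𝓡 n) γ t (1 : ℝ)) = k I) :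
    g.IsGeodesicOn γ s₀ s₁ := by
  refine ⟨hγ, fun e he s hs hse => ?_⟩
  set u : ℝ → Model n := fun t => e (γ t) with hu
  have hW : Set.Ioo s₀ s₁ ∩ γ ⁻¹' e.source ∈ nhds s :=
    Filter.inter_mem (Ioo_mem_nhds hs.1 hs.2)
      ((hγ.contMDiffAt (Ioo_mem_nhds hs.1 hs.2)).continuousAt.preimage_mem_nhds
        (e.open_source.mem_nhds hse))
  have hus : ∀ t ∈ Set.Ioo s₀ s₁ ∩ γ ⁻¹' e.source, ContDiffAt ℝ ∞ u t := fun t ht =>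
    ((contMDiffAt_of_mem_maximalAtlas he ht.2).comp t
      (hγ.contMDiffAt (Ioo_mem_nhds ht.1.1 ht.1.2))).contDiffAt
  have huc : ∀ a, ContDiffAt ℝ ∞ (fun t => u t a) s := fun a =>
    contDiffAt_euclidean.1 (hus s ⟨hs, hse⟩) a
  have hderiv : ∀ t ∈ Set.Ioo s₀ s₁ ∩ γ ⁻¹' e.source, ∀ a,
      (deriv u t) a = deriv (fun t => u t a) t := by
    intro t ht a
    have h := ((hus t ht).differentiableAt (by simp)).hasDerivAt
    exact ((EuclideanSpace.proj (𝕜 := ℝ) a).hasFDerivAt.comp_hasDerivAt t h).deriv.symm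
  have hconst : ∀ I, ∀ᶠ t in nhds s,
      ∑ a, (A I).comp e a (u t) * ((deriv (fun t => u t a) t : ℝ) : ℂ) = k I := by
    intro I
    filter_upwards [hW] with t ht
    rw [← hk t ht.1 I, OneForm.apply_velocity _ he
      ((hγ.contMDiffAt (Ioo_mem_nhds ht.1.1 ht.1.2)).mdifferentiableAt (by simp)) ht.2,
      OneForm.pullback_apply]
    refine Finset.sum_congr rfl fun a _ => ?_
    rw [hderiv t ht a, mul_comm]
    rfl
  have hx : u s ∈ e.target := e.map_source hse
  have hpd : ∀ I a b, partialDeriv b ((A I).comp e a) (u s)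
      = ∑ c, (A I).comp e c (u s) * (g.christoffel e c b a (u s) : ℂ) := fun I a b =>
    (congrFun (congrFun (matDeriv_frame hA hc he hx b) I) a).trans (Matrix.mul_apply ..)
  have hd2 : ∀ a, HasDerivAt (deriv fun t => u t a) (deriv (deriv fun t => u t a) s) s := by
    intro a
    have h : ContDiffAt ℝ 1 (fun t => fderiv ℝ (fun t => u t a) t 1) s :=
      ((huc a).fderiv_right (m := 1) (by
        simpa using! WithTop.coe_le_coe.2 (le_top : (2 : ℕ∞) ≤ ⊤))).clm_apply contDiffAt_const
    exact (h.differentiableAt one_ne_zero).hasDerivAt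
  -- The left-hand side of the geodesic equation. Differentiating `A_I(γ') = k I` and using
  -- parallelism yields `F z = 0`, whence `z = 0`.
  let z : Fin n → ℂ := fun c => ((deriv (deriv fun t => u t c) s
        + ∑ a, ∑ b, g.christoffel e c a b (u s)
            * deriv (fun t => u t a) s * deriv (fun t => u t b) s : ℝ) : ℂ)
  have hz : (frame A e (u s)).mulVec z = 0 := by
    funext I
    have hD : HasDerivAt (fun t => ∑ a, (A I).comp e a (u t) * ((deriv (fun t => u t a) t : ℝ) : ℂ))
        (∑ a, ((∑ b, ((deriv u s) b : ℂ) * partialDeriv b ((A I).comp e a) (u s))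
            * ((deriv (fun t => u t a) s : ℝ) : ℂ)
          + (A I).comp e a (u s) * ((deriv (deriv fun t => u t a) s : ℝ) : ℂ))) s :=
      HasDerivAt.fun_sum fun a _ => (hasDerivAt_comp_partialDeriv
        (differentiableAt_frame hA.smooth he hx I a)
        ((hus s ⟨hs, hse⟩).differentiableAt (by simp)).hasDerivAt).fun_mul (hd2 a).ofReal_comp
    have h0 := hD.unique ((hasDerivAt_const s (k I)).congr_of_eventuallyEq (hconst I))
    refine Eq.trans ?_ h0
    simp only [hderiv s ⟨hs, hse⟩, hpd]
    change ∑ c, (A I).comp e c (u s) * z c = _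
    simp only [z, Complex.ofReal_add, Complex.ofReal_sum, Complex.ofReal_mul, mul_add,
      Finset.sum_add_distrib, Finset.mul_sum, Finset.sum_mul]
    rw [add_comm]
    congr 1
    rw [Finset.sum_comm, Finset.sum_congr rfl fun a _ => Finset.sum_comm, Finset.sum_comm]
    exact Finset.sum_congr rfl fun b _ => Finset.sum_congr rfl fun a _ =>
      Finset.sum_congr rfl fun c _ => by ring
  have hz0 := Matrix.eq_zero_of_mulVec_eq_zero (det_frame_ne_zero hA.linearIndependent he hx) hz
  intro c
  exact Complex.ofReal_eq_zero.1 (congrFun hz0 c)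

/-! ### Local flat coordinates -/

/-- Since `Γ` is real, the conjugate frame `Y` is parallel too, so `F Y⁻¹` is constant on the ball.
Rearranged, `F(x₀)⁻¹ F(x) = Y(x₀)⁻¹ Y(x)`, the conjugate of the left side. -/
theorem frame_inv_mul_real [IsManifold (𝓡 n) ∞ M] (hA : g.IsTakagiFactorization A)
    (hc : ∀ I, (A I).IsClosed) (he : IsChart e) {x₀ : Model n} {r : ℝ} (hr0 : 0 < r)
    (hr : Metric.ball x₀ r ⊆ e.target) {x : Model n} (hx : x ∈ Metric.ball x₀ r) (i j : Fin n) :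
    star (((frame A e x₀)⁻¹ * frame A e x) i j) = ((frame A e x₀)⁻¹ * frame A e x) i j := by
  let S : Matrix (Fin n) (Fin n) ℂ →+* Matrix (Fin n) (Fin n) ℂ := (starRingEnd ℂ).mapMatrix
  let Y : Model n → Matrix (Fin n) (Fin n) ℂ := fun y => S (frame A e y)
  have hx0 := Metric.mem_ball_self hr0 (x := x₀)
  have hdF : ∀ y ∈ Metric.ball x₀ r, (frame A e y).det ≠ 0 := fun y hy =>
    det_frame_ne_zero hA.linearIndependent he (hr hy)
  have hdY : ∀ y ∈ Metric.ball x₀ r, (Y y).det ≠ 0 := by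
    intro y hy h
    have h1 : (Y y).det = star (frame A e y).det := ((starRingEnd ℂ).map_det _).symm
    rw [h1, star_eq_zero] at h
    exact hdF y hy h
  have hYs : ∀ y ∈ Metric.ball x₀ r, ∀ i j, ContDiffAt ℝ ∞ (fun z => Y z i j) y := fun y hy i j =>
    (Complex.conjCLE : ℂ →L[ℝ] ℂ).contDiff.contDiffAt.comp y
      (contDiffAt_frame hA.smooth he (hr hy) i j)
  have hYΓ : ∀ y ∈ Metric.ball x₀ r, ∀ a, matDeriv a Y y = Y y * connMatrix g e a y := by
    intro y hy a
    have h1 : matDeriv a Y y = S (matDeriv a (frame A e) y) := by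
      ext i j
      exact partialDeriv_conj (differentiableAt_frame hA.smooth he (hr hy) i j)
    have h2 : S (connMatrix g e a y) = connMatrix g e a y := by
      ext i j
      exact Complex.conj_ofReal _
    rw [h1, matDeriv_frame hA hc he (hr hy), map_mul, h2]
  have hconst : frame A e x * (Y x)⁻¹ = frame A e x₀ * (Y x₀)⁻¹ := by
    ext i j
    refine Metric.isOpen_ball.is_const_of_fderiv_eq_zero (𝕜 := ℝ)
      (f := fun y => (frame A e y * (Y y)⁻¹) i j)
      (convex_ball x₀ r).isPreconnected (fun y hy => ?_) (fun y hy => ?_) hx hx0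
    · refine DifferentiableAt.differentiableWithinAt ?_
      simp only [Matrix.mul_apply]
      exact DifferentiableAt.fun_sum fun k _ =>
        (differentiableAt_frame hA.smooth he (hr hy) i k).fun_mul
        ((contDiffAt_matrix_inv (hYs y hy) (hdY y hy) k j).differentiableAt (by simp))
    · exact fderiv_mul_inv_eq_zero (contDiffAt_frame hA.smooth he (hr hy)) (hYs y hy) (hdY y hy)
        (matDeriv_frame hA hc he (hr hy)) (hYΓ y hy) i j
  have hS : S ((frame A e x₀)⁻¹) = (Y x₀)⁻¹ := by
    refine (Matrix.inv_eq_left_inv ?_).symm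
    rw [← map_mul, Matrix.nonsing_inv_mul _ (isUnit_iff_ne_zero.2 (hdF x₀ hx0)), map_one]
  have hfin : S ((frame A e x₀)⁻¹ * frame A e x) = (frame A e x₀)⁻¹ * frame A e x := by
    rw [map_mul, hS]
    have h1 := congrArg (fun Q => (frame A e x₀)⁻¹ * Q * Y x) hconst
    simp only [Matrix.mul_assoc, Matrix.nonsing_inv_mul _ (isUnit_iff_ne_zero.2 (hdY x hx)),
      Matrix.mul_one] at h1
    rw [h1, ← Matrix.mul_assoc, Matrix.nonsing_inv_mul _ (isUnit_iff_ne_zero.2 (hdF x₀ hx0)),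
      Matrix.one_mul]
  exact congrFun (congrFun hfin i) j

/-- Flat coordinates near a point: the forms have constant components in them. -/
theorem exists_flat_coordinates [IsManifold (𝓡 n) ∞ M] (hA : g.IsTakagiFactorization A)
    (hc : ∀ I, (A I).IsClosed) (he : IsChart e) {x₀ : Model n} {r : ℝ} (hr0 : 0 < r)
    (hr : Metric.ball x₀ r ⊆ e.target) :
    ∃ ψ : Model n → Model n, ContDiffOn ℝ ∞ ψ (Metric.ball x₀ r) ∧
      ∀ x ∈ Metric.ball x₀ r, ∀ (v : Model n) (I : Fin n),
        ∑ J, frame A e x₀ I J * ((fderiv ℝ ψ x v J : ℝ) : ℂ) = (A I).pullback e x v := by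
  choose f hf hf' using fun I => (A I).exists_primitive_on_ball (hA.smooth I) (hc I) he hr
  have hu : IsUnit (frame A e x₀).det := isUnit_iff_ne_zero.2
    (det_frame_ne_zero hA.linearIndependent he (hr (Metric.mem_ball_self hr0)))
  let h : Fin n → Model n → ℂ := fun J x => ∑ I, (frame A e x₀)⁻¹ J I * f I x
  have hh : ∀ J, ContDiffOn ℝ ∞ (h J) (Metric.ball x₀ r) := fun J =>
    ContDiffOn.sum fun I _ => contDiffOn_const.mul (hf I)
  have hh' : ∀ J, ∀ x ∈ Metric.ball x₀ r, HasFDerivAt (h J)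
      (∑ I, (frame A e x₀)⁻¹ J I • (A I).pullback e x) x := fun J x hx =>
    HasFDerivAt.fun_sum fun I _ => (hf' I x hx).const_mul _
  -- Taking real parts loses nothing in the differential: `dh J` has the entries of `F(x₀)⁻¹ F(x)`
  -- as components, and these are real.
  let ψ : Model n → Model n := fun x => WithLp.toLp 2 fun J => (h J x).re
  have hψ : ContDiffOn ℝ ∞ ψ (Metric.ball x₀ r) := contDiffOn_euclidean.2 fun J =>
    Complex.reCLM.contDiff.comp_contDiffOn (hh J)
  refine ⟨ψ, hψ, fun x hx v I => ?_⟩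
  have hψd : DifferentiableAt ℝ ψ x :=
    (hψ.contDiffAt (Metric.isOpen_ball.mem_nhds hx)).differentiableAt (by simp)
  have hcoord : ∀ J, ((fderiv ℝ ψ x v J : ℝ) : ℂ)
      = ∑ a, (v a : ℂ) * ((frame A e x₀)⁻¹ * frame A e x) J a := by
    intro J
    have h1 : HasFDerivAt (fun y => ψ y J) ((EuclideanSpace.proj (𝕜 := ℝ) J).comp (fderiv ℝ ψ x)) x :=
      (EuclideanSpace.proj (𝕜 := ℝ) J).hasFDerivAt.comp x hψd.hasFDerivAt
    have h2 : HasFDerivAt (fun y => ψ y J) (Complex.reCLM.comp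
        (∑ I, (frame A e x₀)⁻¹ J I • (A I).pullback e x)) x :=
      Complex.reCLM.hasFDerivAt.comp x (hh' J x hx)
    have h3 : fderiv ℝ ψ x v J = (∑ I, (frame A e x₀)⁻¹ J I * (A I).pullback e x v).re := by
      have := congrArg (fun L : Model n →L[ℝ] ℝ => L v) (h1.unique h2)
      simpa [sum_apply] using this
    have h4 : ∑ I, (frame A e x₀)⁻¹ J I * (A I).pullback e x v
        = ∑ a, (v a : ℂ) * ((frame A e x₀)⁻¹ * frame A e x) J a := by
      simp only [OneForm.pullback_apply, Finset.mul_sum, Matrix.mul_apply]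
      rw [Finset.sum_comm]
      refine Finset.sum_congr rfl fun a _ => Finset.sum_congr rfl fun I _ => ?_
      rw [Complex.real_smul, mul_left_comm]
      rfl
    rw [h3, h4, ← Complex.conj_eq_iff_re, map_sum]
    refine Finset.sum_congr rfl fun a _ => ?_
    rw [map_mul, Complex.conj_ofReal]
    congr 1
    exact frame_inv_mul_real hA hc he hr0 hr hx J a
  simp only [hcoord, Finset.mul_sum]
  rw [Finset.sum_comm, OneForm.pullback_apply]
  refine Finset.sum_congr rfl fun a _ => ?_
  have h5 : frame A e x₀ * ((frame A e x₀)⁻¹ * frame A e x) = frame A e x := by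
    rw [← Matrix.mul_assoc, Matrix.mul_nonsing_inv _ hu, Matrix.one_mul]
  have h6 := congrFun (congrFun h5 I) a
  rw [Matrix.mul_apply] at h6
  rw [Complex.real_smul, show (A I).comp e a x = frame A e x I a from rfl, ← h6, Finset.mul_sum]
  exact Finset.sum_congr rfl fun J _ => mul_left_comm _ _ _

/-- Geodesics of a closed factorization exist for all initial data. -/
theorem exists_geodesic [IsManifold (𝓡 n) ∞ M] (hA : g.IsTakagiFactorization A)
    (hc : ∀ I, (A I).IsClosed) (he : IsChart e) {x₀ : Model n} (hx₀ : x₀ ∈ e.target)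
    (w : Model n) :
    ∃ δ > 0, ∃ γ : ℝ → M, g.IsGeodesicOn γ (-δ) δ ∧ e (γ 0) = x₀ ∧
      (∀ t ∈ Set.Ioo (-δ) δ, γ t ∈ e.source) ∧ HasDerivAt (fun t => e (γ t)) w 0 := by
  obtain ⟨r, hr0, hr⟩ := Metric.isOpen_iff.1 e.open_target x₀ hx₀
  obtain ⟨ψ, hψ, hψA⟩ := exists_flat_coordinates hA hc he hr0 hr
  have hx₀r := Metric.mem_ball_self hr0 (x := x₀)
  have hcd : ∀ x ∈ Metric.ball x₀ r, ContDiffAt ℝ ∞ ψ x := fun x hx =>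
    hψ.contDiffAt (Metric.isOpen_ball.mem_nhds hx)
  have hd : ∀ x ∈ Metric.ball x₀ r, HasFDerivAt ψ (fderiv ℝ ψ x) x := fun x hx =>
    ((hcd x hx).differentiableAt (by simp)).hasFDerivAt
  have hfm : ∀ x (v : Model n) I, (A I).pullback e x v
      = (frame A e x).mulVec (fun a => (v a : ℂ)) I := by
    intro x v I
    rw [OneForm.pullback_apply]
    exact Finset.sum_congr rfl fun a _ => by rw [Complex.real_smul, mul_comm]; rfl
  have hinj : ∀ x ∈ Metric.ball x₀ r, Function.Injective (fderiv ℝ ψ x) := by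
    intro x hx
    rw [injective_iff_map_eq_zero]
    intro v hv
    have h1 : (frame A e x).mulVec (fun a => (v a : ℂ)) = 0 := by
      funext I
      rw [← hfm, ← hψA x hx v I, hv]
      simp
    have h2 := Matrix.eq_zero_of_mulVec_eq_zero
      (det_frame_ne_zero hA.linearIndependent he (hr hx)) h1
    ext a
    exact Complex.ofReal_eq_zero.1 (congrFun h2 a)
  -- Normalizing by the frame at `x₀` makes the derivative of `ψ` there the identity, so the inverse
  -- function theorem applies and `w` is itself the initial velocity.
  have hid : ∀ v, fderiv ℝ ψ x₀ v = v := by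
    intro v
    have h1 : (frame A e x₀).mulVec (fun a => ((fderiv ℝ ψ x₀ v a - v a : ℝ) : ℂ)) = 0 := by
      funext I
      have h3 := (hψA x₀ hx₀r v I).trans (hfm x₀ v I)
      simp only [Matrix.mulVec, dotProduct, Complex.ofReal_sub, mul_sub, Finset.sum_sub_distrib]
      exact sub_eq_zero.2 h3
    have h2 := Matrix.eq_zero_of_mulVec_eq_zero
      (det_frame_ne_zero hA.linearIndependent he hx₀) h1
    ext a
    exact sub_eq_zero.1 (Complex.ofReal_eq_zero.1 (congrFun h2 a))
  have hd₀ : HasFDerivAt ψ ((ContinuousLinearEquiv.refl ℝ (Model n) : Model n ≃L[ℝ] Model n) :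
      Model n →L[ℝ] Model n) x₀ := by
    convert hd x₀ hx₀r using 1
    ext1 v
    exact (hid v).symm
  let Φ := ((hcd x₀ hx₀r).toOpenPartialHomeomorph ψ hd₀ (by simp)).restrOpen
    (Metric.ball x₀ r) Metric.isOpen_ball
  have hΦψ : ∀ x, Φ x = ψ x := fun _ => rfl
  have hΦs : ∀ x ∈ Φ.source, x ∈ Metric.ball x₀ r := fun x hx => hx.2
  have hx₀Φ : x₀ ∈ Φ.source :=
    ⟨(hcd x₀ hx₀r).mem_toOpenPartialHomeomorph_source hd₀ (by simp), hx₀r⟩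
  let z : ℝ → Model n := fun t => ψ x₀ + t • w
  have hz : ContDiff ℝ ∞ z := contDiff_const.add (contDiff_id.smul contDiff_const)
  have hz' : ∀ t, HasDerivAt z w t := fun t => by
    simpa only [one_smul] using! ((hasDerivAt_id t).smul_const w).const_add (ψ x₀)
  have hz0 : z 0 = Φ x₀ := by simp [z, hΦψ]
  obtain ⟨δ, hδ, hδΦ⟩ := Metric.isOpen_iff.1 (Φ.open_target.preimage hz.continuous) 0
    (by rw [Set.mem_preimage, hz0]; exact Φ.map_source hx₀Φ)
  rw [Real.ball_eq_Ioo, zero_sub, zero_add] at hδΦ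
  let σ : ℝ → Model n := fun t => Φ.symm (z t)
  have hσb : ∀ t ∈ Set.Ioo (-δ) δ, σ t ∈ Metric.ball x₀ r := fun t ht =>
    hΦs _ (Φ.map_target (hδΦ ht))
  have hσs : ∀ t ∈ Set.Ioo (-δ) δ, ContDiffAt ℝ ∞ σ t := by
    intro t ht
    have hb := hσb t ht
    -- An injective endomorphism in finite dimension is invertible; this gives smoothness of the
    -- inverse along the whole segment, not only at `x₀`.
    let E : Model n ≃L[ℝ] Model n :=
      (LinearEquiv.ofInjectiveEndo (fderiv ℝ ψ (σ t) : Model n →ₗ[ℝ] Model n)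
        (hinj _ hb)).toContinuousLinearEquiv
    have hE : (E : Model n →L[ℝ] Model n) = fderiv ℝ ψ (σ t) := by
      ext1 v
      rfl
    exact (Φ.contDiffAt_symm (f₀' := E) (hδΦ ht) (hE ▸ hd _ hb) (hcd _ hb)).comp t hz.contDiffAt
  have hzero : (0 : ℝ) ∈ Set.Ioo (-δ) δ := ⟨by linarith, hδ⟩
  have hσ0 : σ 0 = x₀ := by
    simp only [σ, hz0]
    exact Φ.left_inv hx₀Φ
  have hσd : ∀ t ∈ Set.Ioo (-δ) δ, fderiv ℝ ψ (σ t) (deriv σ t) = w := by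
    intro t ht
    have h1 := (hd _ (hσb t ht)).comp_hasDerivAt t
      ((hσs t ht).differentiableAt (by simp)).hasDerivAt
    refine h1.unique ((hz' t).congr_of_eventuallyEq ?_)
    filter_upwards [Ioo_mem_nhds ht.1 ht.2] with t' ht'
    exact Φ.right_inv (hδΦ ht')
  have heσ : ∀ t ∈ Set.Ioo (-δ) δ, e (e.symm (σ t)) = σ t := fun t ht =>
    e.right_inv (hr (hσb t ht))
  have hγs : ∀ t ∈ Set.Ioo (-δ) δ, e.symm (σ t) ∈ e.source := fun t ht =>
    e.map_target (hr (hσb t ht))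
  have hev : ∀ t ∈ Set.Ioo (-δ) δ, (fun t => e (e.symm (σ t))) =ᶠ[nhds t] σ := fun t ht =>
    Filter.eventually_of_mem (Ioo_mem_nhds ht.1 ht.2) heσ
  have hγ : ContMDiffOn 𝓘(ℝ, ℝ) (𝓡 n) ∞ (fun t => e.symm (σ t)) (Set.Ioo (-δ) δ) := by
    intro t ht
    exact ((contMDiffAt_symm_of_mem_maximalAtlas he (hr (hσb t ht))).comp t
      (hσs t ht).contMDiffAt).contMDiffWithinAt
  refine ⟨δ, hδ, fun t => e.symm (σ t), ?_, ?_, hγs, ?_⟩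
  -- In the coordinates `ψ` the curve is a line of direction `w` and the forms have constant
  -- coefficients `F(x₀)`, so their values on the velocity are the entries of `F(x₀) w`.
  · refine Metric.isGeodesicOn_of_velocity hA hc hγ
      (k := fun I => ∑ J, frame A e x₀ I J * ((w J : ℝ) : ℂ)) fun t ht I => ?_
    rw [OneForm.apply_velocity _ he
      ((hγ.contMDiffAt (Ioo_mem_nhds ht.1 ht.2)).mdifferentiableAt (by simp)) (hγs t ht),
      (hev t ht).deriv_eq, heσ t ht, ← hψA _ (hσb t ht), hσd t ht]
  · rw [heσ 0 hzero, hσ0]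
  · have h1 := ((hσs 0 hzero).differentiableAt (by simp)).hasDerivAt
    have h2 := hσd 0 hzero
    rw [hσ0, hid] at h2
    rw [h2] at h1
    exact h1.congr_of_eventuallyEq (hev 0 hzero)

/-- Coordinates in which all geodesics are straight have vanishing Christoffel symbols. -/
theorem Metric.connectionNullIn_of_geodesicsStraightIn [IsManifold (𝓡 n) ∞ M]
    (hA : g.IsTakagiFactorization A) (hc : ∀ I, (A I).IsClosed) {y : M → Model n}
    (hstr : g.GeodesicsStraightIn y) : g.ConnectionNullIn y := by
  intro e he hye x hx c
  have hq : ∀ w : Model n, ∑ a, ∑ b, g.christoffel e c a b x * w a * w b = 0 := by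
    intro w
    obtain ⟨δ, hδ, γ, hγ, hγ0, hγs, hγd⟩ := exists_geodesic hA hc he hx w
    obtain ⟨q, v, hqv⟩ := hstr (-δ) δ γ (by linarith) hγ
    have hzero : (0 : ℝ) ∈ Set.Ioo (-δ) δ := ⟨by linarith, hδ⟩
    have hline : (fun t => e (γ t) c) =ᶠ[nhds 0] fun t => q c + t * v c := by
      filter_upwards [Ioo_mem_nhds hzero.1 hzero.2] with t ht
      rw [← hye (hγs t ht), hqv t ht]
      simp
    have h2 : deriv (deriv fun t => e (γ t) c) 0 = 0 := by
      rw [hline.deriv.deriv_eq]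
      have : (deriv fun t => q c + t * v c) = fun _ => v c := by
        funext t
        simp
      rw [this, deriv_const]
    have h1 : ∀ a, deriv (fun t => e (γ t) a) 0 = w a := fun a =>
      ((EuclideanSpace.proj (𝕜 := ℝ) a).hasFDerivAt.comp_hasDerivAt 0 hγd).deriv
    have h3 := hγ.2 e he 0 hzero (hγs 0 hzero) c
    simpa only [h2, h1, hγ0, zero_add] using h3
  intro a b
  have hsingle : ∀ a, g.christoffel e c a a x = 0 := fun a => by
    simpa [stdVec, Pi.single_apply] using hq (stdVec n a)
  -- Polarization: the diagonal terms vanish, leaving `Γ^c_{ab} + Γ^c_{ba} = 0`, and the symbols are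
  -- symmetric.
  have hab := hq (stdVec n a + stdVec n b)
  simp only [stdVec, PiLp.add_apply, PiLp.single_apply, mul_add, mul_ite, mul_one,
    mul_zero, Finset.sum_add_distrib, Finset.sum_ite_eq', Finset.mem_univ, if_true,
    hsingle] at hab
  have hs := congrFun (g.christoffel_symm e c a b) x
  linarith

end Geodesics

end Takagi

end

theorem mainTheorem4 {n : ℕ} {M : Type*} [TopologicalSpace M] [T2Space M]
    [SecondCountableTopology M] [ConnectedSpace M]
    [ChartedSpace (EuclideanSpace ℝ (Fin n)) M] [IsManifold (𝓡 n) ∞ M]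
    (g : Takagi.Metric n M) (A : Fin n → Takagi.OneForm n M)
    (hA : g.IsTakagiFactorization A)
    (hclosed : ∀ I, (A I).IsClosed) (hnonexact : ¬ ∀ I, (A I).IsExact) :
    ¬ SimplyConnectedSpace M ∧
    g.IsNonCurved ∧
    ¬ g.IsGloballyCartesian ∧
    (∀ y : M → EuclideanSpace ℝ (Fin n), Takagi.IsGlobalCoordinates y →
      ¬ g.ConnectionNullIn y) ∧
    (∀ y : M → EuclideanSpace ℝ (Fin n), Takagi.IsGlobalCoordinates y →
      ¬ g.GeodesicsStraightIn y) := by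
  refine ⟨fun hsc => hnonexact fun I => (A I).isExact_of_isClosed (hA.smooth I) (hclosed I),
    Takagi.Metric.isNonCurved_of_isClosed hA hclosed,
    fun hg => hnonexact (Takagi.Metric.isExact_of_isGloballyCartesian hA hclosed hg),
    fun y hy hn => hnonexact (Takagi.Metric.isExact_of_connectionNullIn hA hclosed hy hn),
    fun y hy hs => hnonexact (Takagi.Metric.isExact_of_connectionNullIn hA hclosed hy
      (Takagi.Metric.connectionNullIn_of_geodesicsStraightIn hA hclosed hs))⟩
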